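/- **Setting.** Let $\mathcal{SC}_0$ be the set of functions $\psi:\mathbb R\to[-\infty,\infty)$ that are concave, closed (upper semicontinuous), proper ($\psi\not\equiv-\infty$) and symmetric about $0$, and put $\mathrm{dom}(\psi)=\{x:\psi(x)>-\infty\}$. For $\theta\in\mathbb R$, $\psi\in\mathcal{SC}_0$ and a distribution function $F$ on $\mathbb R$ let $$\Psi(\theta,\psi,F)=\int\psi(x-\theta)\,dF(x)-\int e^{\psi(x-\theta)}\,dx,\qquad L(F)=\sup_{\theta\in\mathbb R,\ \psi\in\mathcal{SC}_0}\Psi(\theta,\psi,F),$$ and let $(\theta^*(F),\psi^*(F))$ denote a maximizer of $\Psi(\cdot,\cdot,F)$ over $\mathbb R\times\mathcal{SC}_0$, with $g^*(F)=e^{\psi^*(F)}$ (where $e^{-\infty}=0$). *Condition A*: $F$ is non-degenerate and $\int|x|\,dF(x)<\infty$. *Condition B*: the maximizer $\theta^*(F)$ is unique, i.e. any two maximizers of $\Psi(\cdot,\cdot,F)$ have the same first component. Let $X_1,X_2,\dots$ be i.i.d. with distribution function $F_0$, and let $\mathbb F_n$ be the empirical distribution function of $X_1,\dots,X_n$. An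 MLE is a maximizer $(\hat\theta_n,\hat\psi_n)=(\theta^*(\mathbb F_n),\psi^*(\mathbb F_n))$; put $\hat g_n=e^{\hat\psi_n}$. **Theorem.** Suppose $F_0$ satisfies Conditions A and B. Then $L(F_0)$ is finite, the maximizer $(\theta^*(F_0),\psi^*(F_0))$ exists and is unique, and there is $\alpha>0$ such that, almost surely, $L(\mathbb F_n)\to L(F_0)$ as $n\to\infty$, an MLE exists for all sufficiently large $n$, and for every choice of MLEs $(\hat\theta_n,\hat\psi_n)$ (for all large $n$): (a) $\hat\theta_n\to\theta^*(F_0)$; (b) $\hat\psi_n(x)\to\psi^*(F_0)(x)$ for all $x$ in the interior of $\mathrm{dom}(\psi^*(F_0))$; (c) $\limsup_n\hat\psi_n(x)\le\psi^*(F_0)(x)$ for all $x\in\mathbb R$; (d) $\hat g_n(x)\to g^*(F_0)(x)$ for every $x\in\mathbb R$ at which $g^*(F_0)$ is continuous (that is, for all $x$ except possibly the two endpoints of the support of $g^*(F_0)$, and those only if $g^*(F_0)$ jumps there); (e) for all $\alpha_1<\alpha$, $$\int e^{\alpha_1|x|}\,|\hat g_n(x)-g^*(F_0)(x)|\,dx\to0,$$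 and if, moreover, $g^*(F_0)$ is continuous on $\mathbb R$, then also $$\sup_{x\in\mathbb R}e^{\alpha_1|x|}\,|\hat g_n(x)-g^*(F_0)(x)|\to0.$$ -/

import Mathlib

open MeasureTheory ProbabilityTheory Filter Topology
open scoped ENNReal

namespace SymLogConcave

/-- The class `𝒞` of proper closed concave functions `ℝ → [-∞, ∞)`: the hypograph is convex,
the value `∞` is never taken, the value `-∞` is not taken everywhere, and the function is
upper semicontinuous. -/
structure IsClosedProperConcave (ψ : ℝ → EReal) : Prop where
  convex_hypograph : Convex ℝ {p : ℝ × ℝ | (p.2 : EReal) ≤ ψ p.1}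
  ne_top : ∀ x, ψ x ≠ ⊤
  exists_ne_bot : ∃ x, ψ x ≠ ⊥
  upperSemicontinuous : UpperSemicontinuous ψ

/-- The class `𝒮𝒞₀` of the functions in `𝒞` that are symmetric about `0`. -/
def SC₀ : Set (ℝ → EReal) :=
  {ψ | IsClosedProperConcave ψ ∧ ∀ x, ψ (-x) = ψ x}

/-- The effective domain `{x | ψ x > -∞}` of a concave function. -/
def dom (ψ : ℝ → EReal) : Set ℝ := {x | ⊥ < ψ x}

/-- The integral of an extended-real-valued function, as the integral of the positive part minus
the integral of the negative part. It is used only for functions that are bounded above and finite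
measures, where the first term is finite, so that the value is a well-defined element
of `[-∞, ∞)`. -/
noncomputable def eintegral (μ : Measure ℝ) (f : ℝ → EReal) : EReal :=
  ((∫⁻ x, (f x).toENNReal ∂μ : ℝ≥0∞) : EReal) - ((∫⁻ x, (-f x).toENNReal ∂μ : ℝ≥0∞) : EReal)

/-- The criterion function `Ψ(θ, ψ, F) = ∫ ψ(x - θ) dF(x) - ∫ exp(ψ(x - θ)) dx`, where a
distribution function `F` is represented by the corresponding measure on `ℝ`. -/
noncomputable def Psi (θ : ℝ) (ψ : ℝ → EReal) (F : Measure ℝ) : EReal :=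
  eintegral F (fun x => ψ (x - θ)) - ((∫⁻ x, (ψ (x - θ)).exp : ℝ≥0∞) : EReal)

/-- The maximized criterion function `L(F)`. -/
noncomputable def L (F : Measure ℝ) : EReal :=
  ⨆ (θ : ℝ), ⨆ ψ ∈ SC₀, Psi θ ψ F

/-- `(θ, ψ)` is a maximizer of `Ψ(·, ·, F)` over `ℝ × 𝒮𝒞₀`, i.e. a version
of `(θ*(F), ψ*(F))`. For an empirical measure `F` this says that `(θ, ψ)` is an MLE. -/
def IsArgmax (F : Measure ℝ) (θ : ℝ) (ψ : ℝ → EReal) : Prop :=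
  ψ ∈ SC₀ ∧ ∀ θ' : ℝ, ∀ ψ' ∈ SC₀, Psi θ' ψ' F ≤ Psi θ ψ F

/-- Condition A: `F` is non-degenerate and has a finite first moment. -/
def ConditionA (F : Measure ℝ) : Prop :=
  (∀ x : ℝ, F ≠ Measure.dirac x) ∧ Integrable (fun x : ℝ => |x|) F

/-- Condition B: the maximizing location `θ*(F)` is unique. -/
def ConditionB (F : Measure ℝ) : Prop :=
  ∀ θ₁ ψ₁ θ₂ ψ₂, IsArgmax F θ₁ ψ₁ → IsArgmax F θ₂ ψ₂ → θ₁ = θ₂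

/-- The function `g = exp ∘ ψ`, with `exp(-∞) = 0`. -/
noncomputable def expOf (ψ : ℝ → EReal) (x : ℝ) : ℝ := (ψ x).exp.toReal

/-- The empirical measure of the first `n` points of a sequence. -/
noncomputable def empirical (x : ℕ → ℝ) (n : ℕ) : Measure ℝ :=
  (n : ℝ≥0∞)⁻¹ • ∑ i ∈ Finset.range n, Measure.dirac (x i)

end SymLogConcave

/-! The proof is the direct method of the calculus of variations, applied to F₀ itself and then
along the empirical measures.

Coercivity (`exists_uniform_bounds`): if F has mass at least p on both sides of an interval and a
bounded first moment, then Ψ(θ, ψ, F) ≥ C bounds ψ(0) and θ and puts ψ below an envelope A - B|x|. A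
tall ψ with an integrable exponential is a narrow peak, which is heavily penalized by the mass away
from θ. The constants depend on F only through these bounds, so they serve F₀ and the empirical
measures alike.

Compactness (`exists_subseq_convergesTo`): a sequence in `SC₀` with ψ(0) in a bounded range has a
subsequence converging in the sense of `ConvergesTo`.

Semicontinuity (`cost_le_liminf`): K - Ψ is a sum of two integrals of nonnegative functions and is
jointly lower semicontinuous in θ, ψ and F. The first integral is handled by layers and open sets,
the second by Fatou's lemma. With the previous two facts this gives `exists_subseq_limit`, hence a
maximizer. For fixed θ it is unique because the exponential is strictly convex (`isArgmax_unique`);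
Condition B takes care of θ.

Consistency: by the strong law, Ψ at the maximizer for F₀ converges along the sample, so L(F₀) is an
asymptotic lower bound for the empirical maxima. Every subsequence of MLEs therefore has a further
subsequence whose limit attains L(F₀), and this limit is the unique maximizer
(`Approximates.tendsto_isArgmax`). The common envelope turns pointwise convergence into weighted
convergence, and its slope B is the α of the theorem. -/

namespace SymLogConcave

/-! ### Elementary properties of the class, and the criterion as a nonnegative cost. -/

section Basic

variable {ψ : ℝ → EReal}

theorem concave_of_mem (hψ : ψ ∈ SC₀) {a b x y s t : ℝ} (ha : (a : EReal) ≤ ψ x)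
    (hb : (b : EReal) ≤ ψ y) (hs : 0 ≤ s) (ht : 0 ≤ t) (hst : s + t = 1) :
    ((s * a + t * b : ℝ) : EReal) ≤ ψ (s * x + t * y) := by
  have := hψ.1.convex_hypograph (x := (x, a)) ha (y := (y, b)) hb hs ht hst
  simpa using this

/-- When |x| ≤ |y| and y ≠ 0, x is the convex combination of y and -y with weights (1 ± x/y)/2, and
ψ takes the same value at both. -/
theorem anti_of_mem (hψ : ψ ∈ SC₀) {x y : ℝ} (hxy : |x| ≤ |y|) : ψ y ≤ ψ x := by
  rw [← EReal.ge_of_forall_gt_iff_ge]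
  intro a ha
  rcases eq_or_ne y 0 with rfl | hy
  · have : x = 0 := by simpa using hxy
    exact this ▸ ha.le
  have h1 : |x / y| ≤ 1 := by rw [abs_div]; exact div_le_one_of_le₀ hxy (abs_nonneg _)
  obtain ⟨h2, h3⟩ := abs_le.1 h1
  have := concave_of_mem hψ ha.le (((hψ.2 y).symm ▸ ha.le : (a : EReal) ≤ ψ (-y)))
    (s := (1 + x / y) / 2) (t := (1 - x / y) / 2) (by linarith) (by linarith) (by ring)
  convert this using 2
  · ring
  · field_simp
    ring

theorem le_zero_of_mem (hψ : ψ ∈ SC₀) (x : ℝ) : ψ x ≤ ψ 0 :=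
  anti_of_mem hψ (by simp)

theorem exists_coe_eq_zero (hψ : ψ ∈ SC₀) : ∃ M : ℝ, ψ 0 = M := by
  refine ⟨(ψ 0).toReal, (EReal.coe_toReal (hψ.1.ne_top 0) fun h => ?_).symm⟩
  obtain ⟨x, hx⟩ := hψ.1.exists_ne_bot
  exact hx (le_bot_iff.1 (h ▸ le_zero_of_mem hψ x))

theorem measurable_of_mem (hψ : ψ ∈ SC₀) : Measurable ψ :=
  hψ.1.upperSemicontinuous.measurable

theorem measurable_exp_of_mem (hψ : ψ ∈ SC₀) : Measurable fun x => (ψ x).exp :=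
  EReal.measurable_exp.comp (measurable_of_mem hψ)

theorem convex_dom (hψ : ψ ∈ SC₀) : Convex ℝ (dom ψ) := by
  intro x hx y hy s t hs ht hst
  obtain ⟨a, -, ha⟩ := EReal.lt_iff_exists_real_btwn.1 hx
  obtain ⟨b, -, hb⟩ := EReal.lt_iff_exists_real_btwn.1 hy
  exact (EReal.bot_lt_coe _).trans_le (concave_of_mem hψ ha.le hb.le hs ht hst)

theorem volume_frontier_dom (hψ : ψ ∈ SC₀) : volume (frontier (dom ψ)) = 0 :=
  (convex_dom hψ).addHaar_frontier _

/-- The function `x ↦ -|x|` belongs to the class. -/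
theorem neg_abs_mem : (fun x : ℝ => ((-|x| : ℝ) : EReal)) ∈ SC₀ := by
  refine ⟨⟨?_, fun x => EReal.coe_ne_top _, ⟨0, EReal.coe_ne_bot _⟩, ?_⟩, fun x => by simp⟩
  · rintro ⟨x, a⟩ ha ⟨y, b⟩ hb s t hs ht hst
    simp only [Set.mem_ofPred_eq, EReal.coe_le_coe_iff, Prod.smul_mk, smul_eq_mul,
      Prod.mk_add_mk] at ha hb ⊢
    have h1 := abs_add_le (s * x) (t * y)
    rw [abs_mul, abs_mul, abs_of_nonneg hs, abs_of_nonneg ht] at h1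
    nlinarith [mul_le_mul_of_nonneg_left ha hs, mul_le_mul_of_nonneg_left hb ht]
  · exact (continuous_coe_real_ereal.comp (by fun_prop : Continuous fun x : ℝ => -|x|)).upperSemicontinuous

/-- The criterion `K - Ψ`, written as a sum of integrals of nonnegative functions;
it equals `K - Ψ` when `ψ ≤ K`. -/
noncomputable def cost (K θ : ℝ) (ψ : ℝ → EReal) (F : Measure ℝ) : ℝ≥0∞ :=
  ∫⁻ x, ((K : EReal) - ψ (x - θ)).toENNReal ∂F + ∫⁻ x, (ψ x).exp

theorem measurable_gap (hψ : ψ ∈ SC₀) (K θ : ℝ) :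
    Measurable fun x => ((K : EReal) - ψ (x - θ)).toENNReal := by
  have : Measurable fun x => ψ (x - θ) := (measurable_of_mem hψ).comp (by fun_prop)
  simp_rw [sub_eq_add_neg]
  exact (measurable_const.add this.neg).ereal_toENNReal

/-- This is K - v = K⁺ - K⁻ - v⁺ + v⁻ with every subtraction moved across, so that it survives v =
-∞, where both sides are infinite. -/
theorem gap_identity (K : ℝ) {v : EReal} (hv : v ≤ K) :
    ((K : EReal) - v).toENNReal + v.toENNReal + ENNReal.ofReal (-K)
      = (-v).toENNReal + ENNReal.ofReal K := by
  induction v with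
  | bot => simp
  | top => simp at hv
  | coe v =>
    rw [EReal.coe_le_coe_iff] at hv
    rw [← EReal.coe_sub, ← EReal.coe_neg]
    simp only [EReal.real_coe_toENNReal]
    rcases le_total 0 v with h | h <;> rcases le_total 0 K with h' | h' <;>
    · rw [← ENNReal.toReal_eq_toReal_iff' (by finiteness) (by finiteness)]
      rw [ENNReal.toReal_add (by finiteness) (by finiteness),
        ENNReal.toReal_add (by finiteness) (by finiteness),
        ENNReal.toReal_add (by finiteness) (by finiteness)]
      simp only [ENNReal.toReal_ofReal']
      grind

theorem eintegral_eq {μ : Measure ℝ} [IsProbabilityMeasure μ] {f : ℝ → EReal} {K : ℝ}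
    (hf : Measurable f) (hK : ∀ x, f x ≤ K) :
    eintegral μ f = (K : EReal) - ((∫⁻ x, ((K : EReal) - f x).toENNReal ∂μ : ℝ≥0∞) : EReal) := by
  have hm : Measurable fun x => ((K : EReal) - f x).toENNReal := by
    simp_rw [sub_eq_add_neg]
    exact (measurable_const.add hf.neg).ereal_toENNReal
  have key : ∫⁻ x, ((K : EReal) - f x).toENNReal ∂μ + ∫⁻ x, (f x).toENNReal ∂μ
      + ENNReal.ofReal (-K) = ∫⁻ x, (-f x).toENNReal ∂μ + ENNReal.ofReal K := by
    have := lintegral_congr (μ := μ) fun x => gap_identity K (hK x)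
    rw [lintegral_add_right _ measurable_const, lintegral_add_left hm,
      lintegral_add_right _ measurable_const] at this
    simpa using this
  have hfin : ∫⁻ x, (f x).toENNReal ∂μ ≠ ⊤ := by
    refine ne_top_of_le_ne_top (b := ENNReal.ofReal K) (by finiteness) ?_
    calc ∫⁻ x, (f x).toENNReal ∂μ ≤ ∫⁻ _, ENNReal.ofReal K ∂μ :=
          lintegral_mono fun x => by
            simpa using EReal.toENNReal_le_toENNReal (hK x)
      _ = _ := by simp
  unfold eintegral
  generalize ∫⁻ x, (f x).toENNReal ∂μ = P at *
  generalize ∫⁻ x, (-f x).toENNReal ∂μ = N at *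
  generalize ∫⁻ x, ((K : EReal) - f x).toENNReal ∂μ = G at *
  lift P to NNReal using hfin
  rcases eq_or_ne N ⊤ with rfl | hN
  · have : G = ⊤ := by
      simpa [ENNReal.add_eq_top] using key
    subst this
    simp
  · have hG : G ≠ ⊤ := by
      rintro rfl
      simp [ENNReal.add_eq_top, hN, eq_comm] at key
    lift N to NNReal using hN
    lift G to NNReal using hG
    have := congrArg ENNReal.toReal key
    rw [ENNReal.toReal_add (by finiteness) (by finiteness),
        ENNReal.toReal_add (by finiteness) (by finiteness),
        ENNReal.toReal_add (by finiteness) (by finiteness)] at this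
    simp only [ENNReal.toReal_ofReal', ENNReal.coe_toReal] at this
    have h2 : max K 0 - max (-K) 0 = K := by grind
    have e : ∀ r : NNReal, (((r : ℝ≥0∞) : EReal)) = ((r : ℝ) : EReal) := fun r => rfl
    rw [e, e, e, ← EReal.coe_sub, ← EReal.coe_sub]
    congr 1
    linarith

theorem Psi_eq {F : Measure ℝ} [IsProbabilityMeasure F] (hψ : ψ ∈ SC₀) {K : ℝ} (hK : ψ 0 ≤ K)
    (θ : ℝ) : Psi θ ψ F = (K : EReal) - ((cost K θ ψ F : ℝ≥0∞) : EReal) := by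
  have hm : Measurable fun x => ψ (x - θ) := (measurable_of_mem hψ).comp (by fun_prop)
  rw [Psi, eintegral_eq hm fun x => (le_zero_of_mem hψ _).trans hK, cost,
    lintegral_sub_right_eq_self (fun x => (ψ x).exp) θ, EReal.coe_ennreal_add]
  rw [sub_eq_add_neg, sub_eq_add_neg, sub_eq_add_neg, EReal.neg_add, sub_eq_add_neg, add_assoc]
  · left; simp
  · right; simp

/-- The separate condition c ≤ K is needed because `ENNReal.ofReal` truncates at zero: for K < c and
J = 0 the second condition alone would hold. -/
theorem coe_le_sub_iff {c K : ℝ} {J : ℝ≥0∞} :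
    (c : EReal) ≤ (K : EReal) - (J : EReal) ↔ c ≤ K ∧ J ≤ ENNReal.ofReal (K - c) := by
  induction J with
  | top => simp
  | coe r =>
    have e : (((r : ℝ≥0∞) : EReal)) = ((r : ℝ) : EReal) := rfl
    rw [e, ← EReal.coe_sub, EReal.coe_le_coe_iff]
    constructor
    · intro h
      refine ⟨by linarith [r.coe_nonneg], ?_⟩
      rw [← ENNReal.ofReal_coe_nnreal]
      exact ENNReal.ofReal_le_ofReal (by linarith)
    · rintro ⟨h1, h2⟩
      rw [← ENNReal.ofReal_coe_nnreal, ENNReal.ofReal_le_ofReal_iff (by linarith)] at h2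
      linarith

theorem le_Psi_iff {F : Measure ℝ} [IsProbabilityMeasure F] (hψ : ψ ∈ SC₀) {K c : ℝ}
    (hK : ψ 0 ≤ K) {θ : ℝ} :
    (c : EReal) ≤ Psi θ ψ F ↔ c ≤ K ∧ cost K θ ψ F ≤ ENNReal.ofReal (K - c) := by
  rw [Psi_eq hψ hK, coe_le_sub_iff]

theorem Psi_le_L (F : Measure ℝ) (hψ : ψ ∈ SC₀) (θ : ℝ) : Psi θ ψ F ≤ L F :=
  le_iSup_of_le θ (le_iSup₂_of_le ψ hψ le_rfl)

theorem isArgmax_iff {F : Measure ℝ} {θ : ℝ} :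
    IsArgmax F θ ψ ↔ ψ ∈ SC₀ ∧ Psi θ ψ F = L F := by
  refine and_congr_right fun hψ => ⟨fun h => le_antisymm (Psi_le_L F hψ θ) ?_, fun h => ?_⟩
  · exact iSup_le fun θ' => iSup₂_le fun ψ' hψ' => h θ' ψ' hψ'
  · intro θ' ψ' hψ'
    exact h ▸ Psi_le_L F hψ' θ'

end Basic

/-! ### Coercivity: uniform bounds on near-maximizers. -/

section Coercivity

variable {ψ : ℝ → EReal}

/-- A bound on the integral of `exp ψ` forces `ψ` to drop within a controlled distance. -/
theorem lt_of_lintegral_exp_le (hψ : ψ ∈ SC₀) {M c : ℝ} (hc : 0 ≤ c)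
    (hI : ∫⁻ x, (ψ x).exp ≤ ENNReal.ofReal c) :
    ψ (Real.exp (1 - M) * (c + 1)) < ((M - 1 : ℝ) : EReal) := by
  by_contra! h
  -- With this w, the box of height exp(M - 1) over [-w, w] has area 2(c + 1), more than the
  -- integral allows.
  set w := Real.exp (1 - M) * (c + 1) with hw
  have hw0 : 0 < w := by positivity
  have h1 : ENNReal.ofReal (Real.exp (M - 1)) * volume (Set.Icc (-w) w)
      ≤ ∫⁻ x, (ψ x).exp := by
    rw [← setLIntegral_const]
    refine (setLIntegral_mono' measurableSet_Icc fun x hx => ?_).trans (setLIntegral_le_lintegral _ _)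
    rw [← EReal.exp_coe, EReal.exp_le_exp_iff]
    exact h.trans (anti_of_mem hψ (by rw [abs_of_pos hw0]; exact abs_le.2 hx))
  have h2 := h1.trans hI
  rw [Real.volume_Icc, ← ENNReal.ofReal_mul (Real.exp_pos _).le,
    ENNReal.ofReal_le_ofReal_iff hc] at h2
  have h3 : Real.exp (M - 1) * (w - -w) = 2 * (c + 1) := by
    have : Real.exp (M - 1) * Real.exp (1 - M) = 1 := by
      rw [← Real.exp_add]; simp
    rw [hw]
    linear_combination 2 * (c + 1) * this
  linarith

/-- A drop of `ψ` by one at distance `w` propagates to a linear upper bound. -/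
theorem le_linear_of_lt (hψ : ψ ∈ SC₀) {M w : ℝ} (hM : ψ 0 = M) (hw : 0 < w)
    (h : ψ w < ((M - 1 : ℝ) : EReal)) (x : ℝ) : ψ x ≤ ((M + 1 - |x| / w : ℝ) : EReal) := by
  rcases lt_or_ge |x| w with hx | hx
  · refine (le_zero_of_mem hψ x).trans ?_
    rw [hM, EReal.coe_le_coe_iff]
    have : |x| / w ≤ 1 := (div_le_one hw).2 hx.le
    linarith
  · rw [← EReal.ge_of_forall_gt_iff_ge]
    intro r hr
    have hx0 : 0 < |x| := hw.trans_le hx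
    have hr' : (r : EReal) ≤ ψ |x| := hr.le.trans (anti_of_mem hψ (by simp))
    -- The chord from (0, M) to (|x|, r) lies below ψ at w, where ψ is below M - 1; this forces r <
    -- M - |x|/w.
    have h1 := concave_of_mem hψ hM.ge hr' (s := 1 - w / |x|) (t := w / |x|)
      (by have := (div_le_one hx0).2 hx; linarith) (by positivity) (by ring)
    have h2 : (1 - w / |x|) * 0 + w / |x| * |x| = w := by field_simp; ring
    rw [h2] at h1
    have h3 := EReal.coe_lt_coe_iff.1 (h1.trans_lt h)
    have h4 : 1 < w / |x| * (M - r) := by linarith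
    rw [EReal.coe_le_coe_iff]
    have h5 : |x| / w < M - r := by
      rw [div_lt_iff₀ hw]
      rw [div_mul_eq_mul_div, lt_div_iff₀ hx0] at h4
      linarith
    linarith

/-- Exponential growth beats quadratic growth; this provides the ceiling K for ψ(0) in
`exists_uniform_bounds`. -/
theorem exists_forall_quadratic_lt_exp {q : ℝ} (hq : 0 < q) (C p : ℝ) :
    ∃ K, C ≤ K ∧ ∀ M, K < M → (M - C + p) * (M - C + 1) < q * Real.exp (M - 1) := by
  have h1 : Tendsto (fun M : ℝ => M - C + 1 + |p|) atTop atTop := by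
    have := tendsto_atTop_add_const_right atTop (- C + 1 + |p|) tendsto_id (α := ℝ)
    refine this.congr fun M => by simp; ring
  have h2 := (Real.tendsto_exp_div_pow_atTop 2).comp h1
  have h3 := (h2.eventually_gt_atTop (1 / (q * Real.exp (C - 2 - |p|)))).and
    (eventually_ge_atTop C)
  obtain ⟨K, hK⟩ := eventually_atTop.1 h3
  refine ⟨max K C, le_max_right _ _, fun M hM => ?_⟩
  obtain ⟨h4, h5⟩ := hK M ((le_max_left _ _).trans hM.le)
  simp only [Function.comp] at h4
  set u := M - C + 1 + |p| with hu
  have hu0 : 0 < u := by have := abs_nonneg p; linarith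
  rw [div_lt_div_iff₀ (by positivity) (by positivity)] at h4
  have h6 : Real.exp u * (q * Real.exp (C - 2 - |p|)) = q * Real.exp (M - 1) := by
    rw [mul_left_comm, ← Real.exp_add]
    congr 2
    rw [hu]; ring
  rw [h6] at h4
  have h7 : (M - C + p) * (M - C + 1) ≤ u ^ 2 := by
    have := le_abs_self p
    have := neg_abs_le p
    nlinarith [mul_nonneg (by linarith : 0 ≤ M - C) (by linarith : 0 ≤ |p| - p), abs_nonneg p,
      mul_nonneg (by linarith : 0 ≤ M - C) (abs_nonneg p)]
  linarith

/-- Uniform bounds on all `(θ, ψ)` at which the criterion is at least `C`, for distributions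
with a bounded first moment and mass at least `p` on both sides of an interval. -/
theorem exists_uniform_bounds {a b p : ℝ} (hab : a < b) (hp : 0 < p) {R : ℝ} (hR : 0 ≤ R) (C : ℝ) :
    ∃ K A B T : ℝ, 0 < B ∧ ∀ (F : Measure ℝ) [IsProbabilityMeasure F] (θ : ℝ) (ψ : ℝ → EReal),
      ENNReal.ofReal p ≤ F (Set.Iio a) → ENNReal.ofReal p ≤ F (Set.Ioi b) →
      ∫⁻ x, ENNReal.ofReal |x| ∂F ≤ ENNReal.ofReal R → ψ ∈ SC₀ → (C : EReal) ≤ Psi θ ψ F →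
      (C : EReal) ≤ ψ 0 ∧ ψ 0 ≤ (K : EReal) ∧ (∀ x, ψ x ≤ ((A - B * |x| : ℝ) : EReal)) ∧
        |θ| ≤ T := by
  set δ := (b - a) / 2 with hδ
  have hδ0 : 0 < δ := by linarith
  obtain ⟨K, hCK, hK⟩ := exists_forall_quadratic_lt_exp (mul_pos hp hδ0) C p
  set W := Real.exp (1 - C) * (K - C + 1) with hW
  have hW0 : 0 < W := mul_pos (Real.exp_pos _) (by linarith)
  refine ⟨K, K + 1, W⁻¹, W * (K - C + 1 + W⁻¹ * R), inv_pos.2 hW0,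
    fun F _ θ ψ hFa hFb hFR hψ hC => ?_⟩
  obtain ⟨M, hM⟩ := exists_coe_eq_zero hψ
  obtain ⟨hCM, hcost⟩ := (le_Psi_iff hψ hM.le).1 hC
  have hI := (self_le_add_left _ _).trans hcost
  have hH := (self_le_add_right _ _).trans hcost
  -- Both parts of the cost are at most M - C, so ψ drops by one within this distance, which is
  -- exponentially small in M.
  set w := Real.exp (1 - M) * (M - C + 1) with hw
  have hw0 : 0 < w := mul_pos (Real.exp_pos _) (by linarith)
  have hlin := le_linear_of_lt hψ hM hw0 (lt_of_lintegral_exp_le hψ (by linarith) hI)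
  have hgap : ∀ x, ENNReal.ofReal (|x - θ| / w - 1)
      ≤ ((M : EReal) - ψ (x - θ)).toENNReal := by
    intro x
    rw [← EReal.real_coe_toENNReal]
    apply EReal.toENNReal_le_toENNReal
    refine le_trans ?_ (EReal.sub_le_sub le_rfl (hlin (x - θ)))
    rw [← EReal.coe_sub, EReal.coe_le_coe_iff]
    linarith
  -- Whichever side of the midpoint θ lies on, the opposite tail stays at distance δ from it.
  have hside : ∃ S : Set ℝ, MeasurableSet S ∧ ENNReal.ofReal p ≤ F S ∧ ∀ x ∈ S, δ ≤ |x - θ| := by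
    rcases le_total θ ((a + b) / 2) with h | h
    · refine ⟨_, measurableSet_Ioi, hFb, fun x hx => ?_⟩
      have := Set.mem_Ioi.1 hx
      exact le_trans (by linarith) (le_abs_self _)
    · refine ⟨_, measurableSet_Iio, hFa, fun x hx => ?_⟩
      have := Set.mem_Iio.1 hx
      exact le_trans (by linarith) (neg_le_abs _)
  obtain ⟨S, hS, hpS, hSδ⟩ := hside
  have h1 : ENNReal.ofReal (δ / w - 1) * ENNReal.ofReal p ≤ ENNReal.ofReal (M - C) := by
    refine le_trans ?_ hH
    refine (mul_le_mul_right hpS _).trans ?_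
    rw [← setLIntegral_const]
    refine (setLIntegral_mono' hS fun x hx => ?_).trans (setLIntegral_le_lintegral _ _)
    refine le_trans (ENNReal.ofReal_le_ofReal ?_) (hgap x)
    have := hSδ x hx
    gcongr
  rw [← ENNReal.ofReal_mul' hp.le, ENNReal.ofReal_le_ofReal_iff (by linarith)] at h1
  -- The mass p at distance δ costs at least p(δ/w - 1), so pδ exp(M - 1) ≤ (M - C + p)(M - C + 1),
  -- which fails beyond K.
  have hMK : M ≤ K := by
    by_contra! h
    have h2 := hK M h
    have h3 : δ / w * p ≤ M - C + p := by linarith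
    have h4 : δ / w * p * (M - C + 1) = p * δ * Real.exp (M - 1) := by
      have : Real.exp (M - 1) * Real.exp (1 - M) = 1 := by
        rw [← Real.exp_add]; simp
      rw [div_mul_eq_mul_div, div_mul_eq_mul_div, div_eq_iff hw0.ne', hw]
      linear_combination (- p * δ * (M - C + 1)) * this
    have h5 := mul_le_mul_of_nonneg_right h3 (by linarith : 0 ≤ M - C + 1)
    linarith
  have hwW : w ≤ W := by
    rw [hw, hW]
    gcongr
  have hinv : ∀ x : ℝ, W⁻¹ * |x| ≤ |x| / w := fun x => by
    rw [div_eq_inv_mul]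
    gcongr
  refine ⟨by rw [hM]; exact_mod_cast hCM, by rw [hM]; exact_mod_cast hMK, fun x => ?_, ?_⟩
  · refine (hlin x).trans ?_
    rw [EReal.coe_le_coe_iff]
    linarith [hinv x]
  · have h6 : ENNReal.ofReal (W⁻¹ * |θ|) ≤ ENNReal.ofReal (K - C + 1 + W⁻¹ * R) := by
      calc ENNReal.ofReal (W⁻¹ * |θ|)
          = ∫⁻ _, ENNReal.ofReal (W⁻¹ * |θ|) ∂F := by simp
        _ ≤ ∫⁻ x, (((M : EReal) - ψ (x - θ)).toENNReal
              + (ENNReal.ofReal 1 + ENNReal.ofReal W⁻¹ * ENNReal.ofReal |x|)) ∂F := by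
            refine lintegral_mono fun x => ?_
            refine le_trans ?_ (add_le_add_left (hgap x) _)
            rw [← ENNReal.ofReal_mul (by positivity), ← ENNReal.ofReal_add (by positivity) (by positivity)]
            refine le_trans (ENNReal.ofReal_le_ofReal ?_) ENNReal.ofReal_add_le
            have h7 := hinv (x - θ)
            have h8 : |θ| ≤ |x - θ| + |x| := by
              have := abs_sub_abs_le_abs_sub θ x
              rw [abs_sub_comm θ x] at this
              linarith
            have := mul_le_mul_of_nonneg_left h8 (inv_pos.2 hW0).le
            linarith
        _ = ∫⁻ x, ((M : EReal) - ψ (x - θ)).toENNReal ∂F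
              + (ENNReal.ofReal 1 + ENNReal.ofReal W⁻¹ * ∫⁻ x, ENNReal.ofReal |x| ∂F) := by
            rw [lintegral_add_left (measurable_gap hψ M θ), lintegral_add_left measurable_const,
              lintegral_const_mul _ (by fun_prop)]
            simp
        _ ≤ ENNReal.ofReal (M - C)
              + (ENNReal.ofReal 1 + ENNReal.ofReal W⁻¹ * ENNReal.ofReal R) := by gcongr
        _ ≤ ENNReal.ofReal (K - C + 1 + W⁻¹ * R) := by
            rw [← ENNReal.ofReal_mul (by positivity), ← ENNReal.ofReal_add (by positivity) (by positivity),
              ← ENNReal.ofReal_add (by linarith) (by positivity)]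
            exact ENNReal.ofReal_le_ofReal (by linarith)
    rw [ENNReal.ofReal_le_ofReal_iff (by have := mul_nonneg (inv_pos.2 hW0).le hR; linarith)] at h6
    rwa [inv_mul_le_iff₀ hW0] at h6

end Coercivity

/-! ### Compactness of the class, by selection on the rationals. -/

section Compactness

/-- The closure of an even function that is nonincreasing in `|x|` and concave: its values are
infima over the open segment towards the origin. -/
noncomputable def radialClosure (φ : ℝ → EReal) (x : ℝ) : EReal :=
  ⨅ t ∈ Set.Ico (0 : ℝ) 1, φ (t * x)

theorem exists_of_radialClosure_lt {φ : ℝ → EReal} {x : ℝ} {c : EReal}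
    (h : radialClosure φ x < c) : ∃ t ∈ Set.Ico (0 : ℝ) 1, φ (t * x) < c := by
  simpa only [radialClosure, iInf_lt_iff, exists_prop] using h

theorem radialClosure_le {φ : ℝ → EReal} {x t : ℝ} (h0 : 0 ≤ t) (h1 : t < 1) :
    radialClosure φ x ≤ φ (t * x) :=
  iInf₂_le t ⟨h0, h1⟩

theorem radialClosure_zero (φ : ℝ → EReal) : radialClosure φ 0 = φ 0 := by
  refine le_antisymm ((radialClosure_le le_rfl one_pos).trans (by simp)) ?_
  exact le_iInf₂ fun t _ => by simp

/-- `ψ` is the limit of the sequence `ψs`: the convergence is pointwise in the interior of the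
domain of `ψ`, and `ψ` bounds the upper limits of `ψs` locally uniformly. -/
structure ConvergesTo (ψs : ℕ → ℝ → EReal) (ψ : ℝ → EReal) : Prop where
  eventually_lt : ∀ x c, ψ x < c → ∀ᶠ p : ℕ × ℝ in atTop ×ˢ 𝓝 x, ψs p.1 p.2 < c
  tendsto : ∀ x ∈ interior (dom ψ), Tendsto (fun n => ψs n x) atTop (𝓝 (ψ x))

/-- A countable product of copies of the compact space `EReal` is sequentially compact, which
replaces a diagonal argument. -/
theorem exists_subseq_tendsto_rat (ψs : ℕ → ℝ → EReal) :
    ∃ ns : ℕ → ℕ, StrictMono ns ∧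
      ∀ q : ℚ, ∃ l, Tendsto (fun k => ψs (ns k) q) atTop (𝓝 l) := by
  obtain ⟨a, ns, hns, h⟩ := CompactSpace.tendsto_subseq fun n (q : ℚ) => ψs n q
  exact ⟨ns, hns, fun q => ⟨a q, (tendsto_pi_nhds.1 h) q⟩⟩

/-- The pointwise lower limit of a sequence of functions. -/
noncomputable def lowerLim (ψs : ℕ → ℝ → EReal) (x : ℝ) : EReal :=
  liminf (fun n => ψs n x) atTop

section Liminf

variable {ψs : ℕ → ℝ → EReal}

theorem lowerLim_anti (hmem : ∀ n, ψs n ∈ SC₀) {x y : ℝ} (h : |x| ≤ |y|) :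
    lowerLim ψs y ≤ lowerLim ψs x :=
  liminf_le_liminf (Eventually.of_forall fun n => anti_of_mem (hmem n) h)

theorem lowerLim_concave (hmem : ∀ n, ψs n ∈ SC₀) {a b x y s t : ℝ}
    (ha : (a : EReal) ≤ lowerLim ψs x) (hb : (b : EReal) ≤ lowerLim ψs y) (hs : 0 ≤ s)
    (ht : 0 ≤ t) (hst : s + t = 1) :
    ((s * a + t * b : ℝ) : EReal) ≤ lowerLim ψs (s * x + t * y) := by
  rw [← EReal.ge_of_forall_gt_iff_ge]
  intro r hr
  rw [EReal.coe_lt_coe_iff] at hr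
  set ε := s * a + t * b - r with hε
  have key : ∀ {z c : ℝ}, (c : EReal) ≤ lowerLim ψs z →
      ∀ᶠ n in atTop, ((c - ε : ℝ) : EReal) < ψs n z := fun {z c} h =>
    eventually_lt_of_lt_liminf (lt_of_lt_of_le (EReal.coe_lt_coe_iff.2 (by linarith)) h)
  refine le_liminf_of_le (by isBoundedDefault) ?_
  filter_upwards [key ha, key hb] with n h1 h2
  refine le_trans (le_of_eq ?_) (concave_of_mem (hmem n) h1.le h2.le hs ht hst)
  congr 1
  linear_combination ε * hst + hε

/-- Take q between t|x| and |x|, or q = 0 at the origin. All y near x satisfy |y| > q in the first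
case, so by monotonicity in the modulus a bound at the one point q transfers to a whole
neighbourhood. -/
theorem exists_rat_of_radialClosure_lt (hmem : ∀ n, ψs n ∈ SC₀) {x : ℝ} {c : EReal}
    (h : radialClosure (lowerLim ψs) x < c) : ∃ q : ℚ, lowerLim ψs q < c ∧
      ∀ᶠ y in 𝓝 x, ∃ t ∈ Set.Ico (0 : ℝ) 1, |t * y| = |(q : ℝ)| := by
  obtain ⟨t, ⟨ht0, ht1⟩, ht⟩ := exists_of_radialClosure_lt h
  rcases eq_or_ne x 0 with rfl | hx
  · refine ⟨0, by simpa using ht, Eventually.of_forall fun y => ⟨0, by simp, by simp⟩⟩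
  · have hx0 : 0 < |x| := abs_pos.2 hx
    obtain ⟨q, hq1, hq2⟩ := exists_rat_btwn (by nlinarith : t * |x| < |x|)
    have hq0 : (0 : ℝ) ≤ q := le_trans (by positivity) hq1.le
    refine ⟨q, (lowerLim_anti hmem ?_).trans_lt ht, ?_⟩
    · rw [abs_mul, abs_of_nonneg ht0, abs_of_nonneg hq0]
      exact hq1.le
    · filter_upwards [continuous_abs.continuousAt.eventually (lt_mem_nhds hq2)] with y hy
      have hy0 : 0 < |y| := lt_of_le_of_lt hq0 hy
      refine ⟨q / |y|, ⟨by positivity, (div_lt_one hy0).2 hy⟩, ?_⟩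
      rw [abs_mul, abs_div, abs_abs, div_mul_cancel₀ _ hy0.ne']

theorem radialClosure_anti (hmem : ∀ n, ψs n ∈ SC₀) {x y : ℝ} (h : |x| ≤ |y|) :
    radialClosure (lowerLim ψs) y ≤ radialClosure (lowerLim ψs) x := by
  refine iInf₂_mono fun t _ => lowerLim_anti hmem ?_
  rw [abs_mul, abs_mul]
  gcongr

theorem radialClosure_zero_le {K : ℝ} (hK : ∀ n, ψs n 0 ≤ K) :
    radialClosure (lowerLim ψs) 0 ≤ K := by
  rw [radialClosure_zero]
  exact liminf_le_of_frequently_le' (Eventually.of_forall hK).frequently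

theorem radialClosure_mem (hmem : ∀ n, ψs n ∈ SC₀) {C K : ℝ} (hC : ∀ n, (C : EReal) ≤ ψs n 0)
    (hK : ∀ n, ψs n 0 ≤ K) : radialClosure (lowerLim ψs) ∈ SC₀ := by
  have h0C : (C : EReal) ≤ lowerLim ψs 0 :=
    le_liminf_of_le (by isBoundedDefault) (Eventually.of_forall hC)
  refine ⟨⟨?_, fun x hx => ?_, ⟨0, ?_⟩, ?_⟩, fun x => ?_⟩
  · rintro ⟨x, a⟩ ha ⟨y, b⟩ hb s t hs ht hst
    simp only [Set.mem_ofPred_eq, Prod.smul_mk, smul_eq_mul, Prod.mk_add_mk] at ha hb ⊢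
    refine le_iInf₂ fun u hu => ?_
    have := lowerLim_concave hmem (ha.trans (radialClosure_le hu.1 hu.2))
      (hb.trans (radialClosure_le hu.1 hu.2)) hs ht hst
    convert this using 2
    ring
  · have h1 : radialClosure (lowerLim ψs) x ≤ K :=
      (radialClosure_anti hmem (by simp)).trans (radialClosure_zero_le hK)
    rw [hx] at h1
    exact absurd h1 (by simp)
  · rw [radialClosure_zero]
    exact ((EReal.bot_lt_coe C).trans_le h0C).ne'
  · intro x c hc
    obtain ⟨q, hq, hy⟩ := exists_rat_of_radialClosure_lt hmem hc
    filter_upwards [hy] with y ⟨t, ht, hty⟩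
    exact ((radialClosure_le ht.1 ht.2).trans (lowerLim_anti hmem hty.ge)).trans_lt hq
  · exact le_antisymm (radialClosure_anti hmem (by simp)) (radialClosure_anti hmem (by simp))

/-- The point x lies between tx and ux with t < 1 < u. The lower limit at tx exceeds a, and at ux it
is at least some real b; concavity bounds it at x by a combination of a and b that tends to a as t →
1. -/
theorem radialClosure_le_of_mem_interior (hmem : ∀ n, ψs n ∈ SC₀) {x : ℝ}
    (hx : x ∈ interior (dom (radialClosure (lowerLim ψs)))) :
    radialClosure (lowerLim ψs) x ≤ lowerLim ψs x := by
  rw [← EReal.ge_of_forall_gt_iff_ge]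
  intro a ha
  have h1 : ∀ᶠ s in 𝓝 (1 : ℝ), s * x ∈ dom (radialClosure (lowerLim ψs)) := by
    have : Tendsto (fun s : ℝ => s * x) (𝓝 1) (𝓝 x) := by
      have : Continuous fun s : ℝ => s * x := by fun_prop
      simpa using this.tendsto 1
    exact this.eventually (mem_interior_iff_mem_nhds.1 hx)
  obtain ⟨s, hs, hs1⟩ := ((h1.filter_mono nhdsWithin_le_nhds).and
    (self_mem_nhdsWithin : Set.Ioi (1 : ℝ) ∈ 𝓝[>] 1)).exists
  obtain ⟨b, -, hb⟩ := EReal.lt_iff_exists_real_btwn.1 hs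
  have hs1 : 1 < s := hs1
  set u := (1 + s) / 2 with hu
  have hu1 : 1 < u := by linarith
  have hbu : (b : EReal) ≤ lowerLim ψs (u * x) := by
    have := hb.le.trans (radialClosure_le (t := u / s) (by positivity)
      ((div_lt_one (by linarith)).2 (by linarith)))
    rwa [← mul_assoc, div_mul_cancel₀ _ (by linarith : s ≠ 0)] at this
  have hf : Tendsto (fun t : ℝ => (u - 1) / (u - t) * a + (1 - t) / (u - t) * b) (𝓝[<] 1) (𝓝 a) := by
    have hc : ContinuousAt (fun t : ℝ => (u - 1) / (u - t) * a + (1 - t) / (u - t) * b) 1 := by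
      have : u - 1 ≠ 0 := by linarith
      fun_prop (disch := assumption)
    have := hc.tendsto.mono_left (nhdsWithin_le_nhds (s := Set.Iio 1))
    simpa [div_self (by linarith : u - 1 ≠ 0)] using this
  refine le_of_tendsto ((continuous_coe_real_ereal.tendsto a).comp hf) ?_
  filter_upwards [self_mem_nhdsWithin, nhdsWithin_le_nhds (eventually_gt_nhds one_pos)] with t ht1 ht0
  have ht1 : t < 1 := ht1
  have hut : 0 < u - t := by linarith
  have := lowerLim_concave hmem (ha.le.trans (radialClosure_le ht0.le ht1)) hbu
    (s := (u - 1) / (u - t)) (t := (1 - t) / (u - t)) (div_nonneg (by linarith) hut.le)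
    (div_nonneg (by linarith) hut.le) (by field_simp; ring)
  have e : (u - 1) / (u - t) * (t * x) + (1 - t) / (u - t) * (u * x) = x := by
    field_simp
    ring
  rwa [e] at this

theorem convergesTo_radialClosure (hmem : ∀ n, ψs n ∈ SC₀)
    (hlim : ∀ q : ℚ, ∃ l, Tendsto (fun n => ψs n q) atTop (𝓝 l)) :
    ConvergesTo ψs (radialClosure (lowerLim ψs)) := by
  have hlt : ∀ x c, radialClosure (lowerLim ψs) x < c →
      ∀ᶠ p : ℕ × ℝ in atTop ×ˢ 𝓝 x, ψs p.1 p.2 < c := by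
    intro x c hc
    obtain ⟨q, hq, hy⟩ := exists_rat_of_radialClosure_lt hmem hc
    obtain ⟨l, hl⟩ := hlim q
    have hn : ∀ᶠ n in atTop, ψs n q < c := hl.eventually_lt_const (hl.liminf_eq ▸ hq)
    filter_upwards [hn.prod_mk hy] with ⟨n, y⟩ ⟨h1, t, ht, hty⟩
    refine (anti_of_mem (hmem n) ?_).trans_lt h1
    rw [← hty, abs_mul, abs_of_nonneg ht.1]
    exact mul_le_of_le_one_left (abs_nonneg _) ht.2.le
  refine ⟨hlt, fun x hx => tendsto_order.2 ⟨fun a ha => ?_, fun c hc => ?_⟩⟩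
  · exact eventually_lt_of_lt_liminf (ha.trans_le (radialClosure_le_of_mem_interior hmem hx))
  · exact (hlt x c hc).curry.mono fun n hn => hn.self_of_nhds

end Liminf

theorem exists_subseq_convergesTo {ψs : ℕ → ℝ → EReal} (hmem : ∀ n, ψs n ∈ SC₀) {C K : ℝ}
    (hC : ∀ n, (C : EReal) ≤ ψs n 0) (hK : ∀ n, ψs n 0 ≤ K) :
    ∃ ns : ℕ → ℕ, StrictMono ns ∧ ∃ ψ ∈ SC₀, ψ 0 ≤ K ∧
      ConvergesTo (fun k => ψs (ns k)) ψ := by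
  obtain ⟨ns, hns, hlim⟩ := exists_subseq_tendsto_rat ψs
  exact ⟨ns, hns, _, radialClosure_mem (fun k => hmem (ns k)) (fun k => hC (ns k))
    (fun k => hK (ns k)), radialClosure_zero_le fun k => hK (ns k), convergesTo_radialClosure (fun k => hmem (ns k)) hlim⟩

end Compactness

/-! ### Joint semicontinuity of the criterion. -/

section Semicontinuity

/-- The lower bound on the mass of open sets that characterizes weak convergence. -/
def LowerWeak (Fs : ℕ → Measure ℝ) (F : Measure ℝ) : Prop :=
  ∀ G, IsOpen G → F G ≤ liminf (fun n => Fs n G) atTop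

/-- The layer-cake formula by Tonelli, in a form that allows h to be infinite, as the gap is outside
the domain of ψ. -/
theorem lintegral_eq_lintegral_lt (μ : Measure ℝ) [SFinite μ] {h : ℝ → ℝ≥0∞} (hh : Measurable h) :
    ∫⁻ x, h x ∂μ = ∫⁻ s in Set.Ioi (0 : ℝ), μ {x | ENNReal.ofReal s < h x} := by
  have h1 : ∀ x, h x = ∫⁻ s in Set.Ioi (0 : ℝ),
      {s : ℝ | ENNReal.ofReal s < h x}.indicator 1 s := by
    intro x
    have hm : MeasurableSet {s : ℝ | ENNReal.ofReal s < h x} :=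
      measurableSet_lt (by fun_prop) measurable_const
    rw [lintegral_indicator_one hm, Measure.restrict_apply hm]
    rcases eq_or_ne (h x) ⊤ with hx | hx
    · have : {s : ℝ | ENNReal.ofReal s < h x} ∩ Set.Ioi 0 = Set.Ioi 0 := by
        ext s; simp [hx]
      rw [this, hx, Real.volume_Ioi]
    · have : {s : ℝ | ENNReal.ofReal s < h x} ∩ Set.Ioi 0 = Set.Ioo 0 (h x).toReal := by
        ext s
        rw [Set.inter_comm]
        refine and_congr_right fun hs => ?_
        rw [Set.mem_ofPred_eq]
        have hs : 0 < s := hs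
        rw [ENNReal.ofReal_lt_iff_lt_toReal hs.le hx]
      rw [this, Real.volume_Ioo, sub_zero, ENNReal.ofReal_toReal hx]
  have h2 : Measurable (Function.uncurry fun (x : ℝ) (s : ℝ) =>
      {s : ℝ | ENNReal.ofReal s < h x}.indicator (1 : ℝ → ℝ≥0∞) s) := by
    have : MeasurableSet {p : ℝ × ℝ | ENNReal.ofReal p.2 < h p.1} :=
      measurableSet_lt (by fun_prop) (hh.comp measurable_fst)
    exact (measurable_one.indicator this : Measurable (Set.indicator _ (1 : ℝ × ℝ → ℝ≥0∞)))
  calc ∫⁻ x, h x ∂μ = ∫⁻ x, (∫⁻ s in Set.Ioi (0 : ℝ),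
        {s : ℝ | ENNReal.ofReal s < h x}.indicator 1 s) ∂μ := lintegral_congr h1
    _ = ∫⁻ s in Set.Ioi (0 : ℝ), (∫⁻ x, {s : ℝ | ENNReal.ofReal s < h x}.indicator 1 s ∂μ) :=
        lintegral_lintegral_swap h2.aemeasurable
    _ = _ := by
        refine lintegral_congr fun s => ?_
        have : MeasurableSet {x | ENNReal.ofReal s < h x} := measurableSet_lt measurable_const hh
        rw [← lintegral_indicator_one this]
        rfl

theorem ofReal_lt_gap_iff {K s : ℝ} (hs : 0 ≤ s) {v : EReal} :
    ENNReal.ofReal s < ((K : EReal) - v).toENNReal ↔ v < ((K - s : ℝ) : EReal) := by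
  induction v with
  | bot => rw [EReal.coe_sub_bot]; simp only [EReal.toENNReal_top, ENNReal.ofReal_lt_top, EReal.bot_lt_coe]
  | top => simp
  | coe v =>
    rw [← EReal.coe_sub, EReal.real_coe_toENNReal, EReal.coe_lt_coe_iff,
      ENNReal.ofReal_lt_ofReal_iff']
    constructor
    · rintro ⟨h1, h2⟩; linarith
    · intro h; constructor <;> linarith

variable {Fs : ℕ → Measure ℝ} {F : Measure ℝ} {ψs : ℕ → ℝ → EReal} {ψ : ℝ → EReal} {θs : ℕ → ℝ}
  {θ : ℝ}

/-- The locally uniform upper bound in `ConvergesTo` also absorbs the moving shift θₙ. The sublevel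
set of the limit is thus covered by the increasing open sets on which the strict inequality holds
for all n ≥ N, and `LowerWeak` applies to each of them. -/
theorem measure_sublevel_le_liminf (hF : LowerWeak Fs F) (hψ : ConvergesTo ψs ψ)
    (hθ : Tendsto θs atTop (𝓝 θ)) (c : EReal) :
    F {x | ψ (x - θ) < c} ≤ liminf (fun n => Fs n {x | ψs n (x - θs n) < c}) atTop := by
  set V : ℕ → Set ℝ := fun N => interior {x | ∀ n ≥ N, ψs n (x - θs n) < c} with hV
  have hmono : Monotone V := fun M N hMN =>
    interior_mono fun x hx n hn => hx n (hMN.trans hn)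
  have hsub : {x | ψ (x - θ) < c} ⊆ ⋃ N, V N := by
    intro x hx
    have ht : Tendsto (fun p : ℕ × ℝ => (p.1, p.2 - θs p.1)) (atTop ×ˢ 𝓝 x)
        (atTop ×ˢ 𝓝 (x - θ)) :=
      tendsto_fst.prodMk (tendsto_snd.sub (hθ.comp tendsto_fst))
    obtain ⟨pa, hpa, pb, hpb, h⟩ := eventually_prod_iff.1 (ht.eventually (hψ.eventually_lt _ c hx))
    obtain ⟨N, hN⟩ := eventually_atTop.1 hpa
    refine Set.mem_iUnion.2 ⟨N, mem_interior_iff_mem_nhds.2 ?_⟩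
    filter_upwards [hpb] with y hy n hn using h (hN n hn) hy
  refine (measure_mono hsub).trans ?_
  rw [hmono.measure_iUnion]
  refine iSup_le fun N => (hF _ isOpen_interior).trans (liminf_le_liminf ?_)
  filter_upwards [eventually_ge_atTop N] with n hn
  exact measure_mono (interior_subset.trans fun x hx => hx n hn)

/-- Fatou's lemma cannot be applied directly since the measures vary; it is applied to the level
variable of the layer-cake formula instead. -/
theorem lintegral_gap_le_liminf [SFinite F] [∀ n, SFinite (Fs n)] (hF : LowerWeak Fs F)
    (hmem : ∀ n, ψs n ∈ SC₀) (hψm : ψ ∈ SC₀) (hψ : ConvergesTo ψs ψ)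
    (hθ : Tendsto θs atTop (𝓝 θ)) (K : ℝ) :
    ∫⁻ x, ((K : EReal) - ψ (x - θ)).toENNReal ∂F
      ≤ liminf (fun n => ∫⁻ x, ((K : EReal) - ψs n (x - θs n)).toENNReal ∂(Fs n)) atTop := by
  have hrw : ∀ (μ : Measure ℝ) [SFinite μ] (χ : ℝ → EReal) (η : ℝ), χ ∈ SC₀ →
      ∫⁻ x, ((K : EReal) - χ (x - η)).toENNReal ∂μ
        = ∫⁻ s in Set.Ioi (0 : ℝ), μ {x | χ (x - η) < ((K - s : ℝ) : EReal)} := by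
    intro μ _ χ η hχ
    rw [lintegral_eq_lintegral_lt μ (measurable_gap hχ K η)]
    refine setLIntegral_congr_fun measurableSet_Ioi fun s hs => ?_
    simp only [ofReal_lt_gap_iff (le_of_lt hs)]
  rw [hrw F ψ θ hψm]
  simp_rw [fun n => hrw (Fs n) (ψs n) (θs n) (hmem n)]
  refine (lintegral_mono fun s => measure_sublevel_le_liminf hF hψ hθ _).trans
    (lintegral_liminf_le fun n => Antitone.measurable fun s t hst => measure_mono fun x hx => ?_)
  exact lt_of_lt_of_le hx (EReal.coe_le_coe_iff.2 (by linarith))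

theorem ConvergesTo.tendsto_of_notMem_frontier (hψ : ConvergesTo ψs ψ) {x : ℝ} (hx : x ∉ frontier (dom ψ)) :
    Tendsto (fun n => ψs n x) atTop (𝓝 (ψ x)) := by
  by_cases h : x ∈ interior (dom ψ)
  · exact hψ.tendsto x h
  · have h1 : x ∉ dom ψ := fun h1 => hx ⟨subset_closure h1, h⟩
    have h2 : ψ x = ⊥ := by simpa [dom] using h1
    refine tendsto_order.2 ⟨fun a ha => absurd ha (by simp [h2]), fun c hc => ?_⟩
    exact (hψ.eventually_lt x c hc).curry.mono fun n hn => hn.self_of_nhds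

/-- Convergence may fail only at the frontier of the convex domain, a null set, so Fatou's lemma
applies. -/
theorem lintegral_exp_le_liminf (hmem : ∀ n, ψs n ∈ SC₀) (hψm : ψ ∈ SC₀)
    (hψ : ConvergesTo ψs ψ) :
    ∫⁻ x, (ψ x).exp ≤ liminf (fun n => ∫⁻ x, (ψs n x).exp) atTop := by
  refine le_trans (lintegral_mono_ae ?_)
    (lintegral_liminf_le fun n => measurable_exp_of_mem (hmem n))
  have : ∀ᵐ x, x ∉ frontier (dom ψ) := measure_eq_zero_iff_ae_notMem.1 (volume_frontier_dom hψm)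
  filter_upwards [this] with x hx
  exact ((ENNReal.continuous_exp.tendsto _).comp
    (hψ.tendsto_of_notMem_frontier hx)).liminf_eq.ge

theorem liminf_add_liminf_le (u v : ℕ → ℝ≥0∞) :
    liminf u atTop + liminf v atTop ≤ liminf (fun n => u n + v n) atTop := by
  simp_rw [liminf_eq_iSup_iInf_of_nat]
  rw [ENNReal.iSup_add_iSup_of_monotone]
  · refine iSup_mono fun N => le_iInf₂ fun n hn => ?_
    exact add_le_add (iInf₂_le n hn) (iInf₂_le n hn)
  all_goals exact fun M N h => le_iInf₂ fun n hn => iInf₂_le n (h.trans hn)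

theorem cost_le_liminf [SFinite F] [∀ n, SFinite (Fs n)] (hF : LowerWeak Fs F)
    (hmem : ∀ n, ψs n ∈ SC₀) (hψm : ψ ∈ SC₀) (hψ : ConvergesTo ψs ψ)
    (hθ : Tendsto θs atTop (𝓝 θ)) (K : ℝ) :
    cost K θ ψ F ≤ liminf (fun n => cost K (θs n) (ψs n) (Fs n)) atTop := by
  refine le_trans (add_le_add (lintegral_gap_le_liminf hF hmem hψm hψ hθ K)
    (lintegral_exp_le_liminf hmem hψm hψ)) ?_
  exact liminf_add_liminf_le _ _

theorem le_Psi_of_convergesTo [IsProbabilityMeasure F] [∀ n, IsProbabilityMeasure (Fs n)]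
    (hF : LowerWeak Fs F) (hmem : ∀ n, ψs n ∈ SC₀) (hψm : ψ ∈ SC₀) (hψ : ConvergesTo ψs ψ)
    (hθ : Tendsto θs atTop (𝓝 θ)) {K : ℝ} (hK : ∀ n, ψs n 0 ≤ K) (hK0 : ψ 0 ≤ K) {c : ℝ}
    (hc : ∀ c' < c, ∀ᶠ n in atTop, (c' : EReal) ≤ Psi (θs n) (ψs n) (Fs n)) :
    (c : EReal) ≤ Psi θ ψ F := by
  rw [← EReal.ge_of_forall_gt_iff_ge]
  intro r hr
  have h1 := hc r (EReal.coe_lt_coe_iff.1 hr)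
  rw [le_Psi_iff hψm hK0]
  have h2 : ∀ᶠ n in atTop, r ≤ K ∧ cost K (θs n) (ψs n) (Fs n) ≤ ENNReal.ofReal (K - r) :=
    h1.mono fun n hn => (le_Psi_iff (hmem n) (hK n)).1 hn
  refine ⟨h2.exists.choose_spec.1, (cost_le_liminf hF hmem hψm hψ hθ K).trans ?_⟩
  exact liminf_le_of_frequently_le' (h2.mono fun n hn => hn.2).frequently

end Semicontinuity

/-! ### Finiteness of L and existence of a maximizer. -/

section Existence

theorem integrable_exp_mul_abs_of_neg {c : ℝ} (hc : c < 0) :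
    Integrable fun x : ℝ => Real.exp (c * |x|) := by
  rw [← integrableOn_univ, ← Set.Iic_union_Ioi (a := (0 : ℝ)), integrableOn_union]
  constructor
  · refine (integrableOn_exp_mul_Iic (neg_pos.2 hc) 0).congr_fun (fun x hx => ?_) measurableSet_Iic
    simp [abs_of_nonpos (Set.mem_Iic.1 hx)]
  · refine (integrableOn_exp_mul_Ioi hc 0).congr_fun (fun x hx => ?_) measurableSet_Ioi
    simp [abs_of_pos (Set.mem_Ioi.1 hx)]

/-- `F` has mass at least `p` to the left of `a` and to the right of `b`, and its first absolute
moment is at most `R`. -/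
structure Spread (a b p R : ℝ) (F : Measure ℝ) : Prop where
  left : ENNReal.ofReal p ≤ F (Set.Iio a)
  right : ENNReal.ofReal p ≤ F (Set.Ioi b)
  moment : ∫⁻ x, ENNReal.ofReal |x| ∂F ≤ ENNReal.ofReal R

theorem bot_lt_L {F : Measure ℝ} [IsProbabilityMeasure F] {R : ℝ}
    (hF : ∫⁻ x, ENNReal.ofReal |x| ∂F ≤ ENNReal.ofReal R) : ⊥ < L F := by
  refine lt_of_lt_of_le ?_ (Psi_le_L F neg_abs_mem 0)
  rw [Psi_eq neg_abs_mem (K := 0) (by simp)]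
  have h : cost 0 0 (fun x : ℝ => ((-|x| : ℝ) : EReal)) F ≠ ⊤ := by
    refine ENNReal.add_ne_top.2 ⟨ne_top_of_le_ne_top (b := ENNReal.ofReal R) (by simp) ?_, ?_⟩
    · refine le_trans (le_of_eq (lintegral_congr fun x => ?_)) hF
      rw [← EReal.coe_sub, EReal.real_coe_toENNReal]
      simp
    · have := (integrable_exp_mul_abs_of_neg (c := -1) (by norm_num)).lintegral_lt_top
      simpa only [neg_one_mul, EReal.exp_coe] using this.ne
  lift cost 0 0 (fun x : ℝ => ((-|x| : ℝ) : EReal)) F to NNReal using h with r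
  have e : (((r : ℝ≥0∞) : EReal)) = ((r : ℝ) : EReal) := rfl
  rw [e, ← EReal.coe_sub]
  exact EReal.bot_lt_coe _

theorem Psi_le_apply_zero {F : Measure ℝ} [IsProbabilityMeasure F] {ψ : ℝ → EReal}
    (hψ : ψ ∈ SC₀) (θ : ℝ) : Psi θ ψ F ≤ ψ 0 := by
  obtain ⟨M, hM⟩ := exists_coe_eq_zero hψ
  rw [Psi_eq hψ hM.le, hM]
  refine EReal.sub_le_of_le_add (le_add_of_nonneg_right (EReal.coe_ennreal_nonneg _))

/-- Either the criterion is negative, or it is at least 0 and the uniform bounds at level 0 apply; Ψ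
≤ ψ(0) then gives the ceiling. -/
theorem L_lt_top {F : Measure ℝ} [IsProbabilityMeasure F] {a b p R : ℝ} (hab : a < b) (hp : 0 < p)
    (hR : 0 ≤ R) (hF : Spread a b p R F) : L F < ⊤ := by
  obtain ⟨K, A, B, T, -, h⟩ := exists_uniform_bounds hab hp hR 0
  refine lt_of_le_of_lt (iSup_le fun θ => iSup₂_le fun ψ hψ => ?_) (EReal.coe_lt_top (max K 0))
  rcases le_total ((0 : ℝ) : EReal) (Psi θ ψ F) with h0 | h0
  · refine (Psi_le_apply_zero hψ θ).trans
      ((h F θ ψ hF.left hF.right hF.moment hψ h0).2.1.trans ?_)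
    exact_mod_cast le_max_left _ _
  · exact h0.trans (by exact_mod_cast le_max_right _ _)

/-- Compactness: pairs with criterion bounded below have a convergent subsequence, and the limit
does at least as well as the sequence. -/
theorem exists_subseq_limit {a b p R : ℝ} (hab : a < b) (hp : 0 < p) (hR : 0 ≤ R)
    {Fs : ℕ → Measure ℝ} {F : Measure ℝ} [∀ n, IsProbabilityMeasure (Fs n)]
    [IsProbabilityMeasure F] (hFs : ∀ n, Spread a b p R (Fs n)) (hF : LowerWeak Fs F)
    {θs : ℕ → ℝ} {ψs : ℕ → ℝ → EReal} (hmem : ∀ n, ψs n ∈ SC₀) {C c : ℝ}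
    (hC : ∀ n, (C : EReal) ≤ Psi (θs n) (ψs n) (Fs n))
    (hc : ∀ c' < c, ∀ᶠ n in atTop, (c' : EReal) ≤ Psi (θs n) (ψs n) (Fs n)) :
    ∃ ns : ℕ → ℕ, StrictMono ns ∧ ∃ θ, ∃ ψ ∈ SC₀, Tendsto (fun k => θs (ns k)) atTop (𝓝 θ) ∧
      ConvergesTo (fun k => ψs (ns k)) ψ ∧ (c : EReal) ≤ Psi θ ψ F := by
  obtain ⟨K, A, B, T, -, h⟩ := exists_uniform_bounds hab hp hR C
  have h' := fun n => h (Fs n) (θs n) (ψs n) (hFs n).left (hFs n).right (hFs n).moment (hmem n) (hC n)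
  obtain ⟨ns, hns, ψ, hψ, hψK, hconv⟩ := exists_subseq_convergesTo hmem (fun n => (h' n).1)
    fun n => (h' n).2.1
  obtain ⟨θ, -, ms, hms, hθ⟩ := (isCompact_Icc (a := -T) (b := T)).tendsto_subseq
    (x := fun k => θs (ns k)) fun k => abs_le.1 (h' (ns k)).2.2.2
  have hconv' : ConvergesTo (fun k => ψs (ns (ms k))) ψ :=
    ⟨fun x c hc => (hms.tendsto_atTop.prodMap tendsto_id).eventually (hconv.eventually_lt x c hc),
      fun x hx => (hconv.tendsto x hx).comp hms.tendsto_atTop⟩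
  have hsub : Tendsto (fun k => ns (ms k)) atTop atTop := hns.tendsto_atTop.comp hms.tendsto_atTop
  refine ⟨fun k => ns (ms k), hns.comp hms, θ, ψ, hψ, hθ, hconv', ?_⟩
  refine le_Psi_of_convergesTo (Fs := fun k => Fs (ns (ms k))) (θs := fun k => θs (ns (ms k)))
    (fun G hG => (hF G hG).trans ?_) (fun k => hmem _) hψ hconv' hθ (fun k => (h' _).2.1) hψK
    (fun c' hc' => hsub.eventually (hc c' hc'))
  exact liminf_le_liminf_of_le hsub (u := fun n => Fs n G)

theorem exists_isArgmax {F : Measure ℝ} [IsProbabilityMeasure F] {a b p R : ℝ} (hab : a < b)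
    (hp : 0 < p) (hR : 0 ≤ R) (hF : Spread a b p R F) : ∃ θ ψ, IsArgmax F θ ψ := by
  obtain ⟨l, hl⟩ : ∃ l : ℝ, L F = l :=
    ⟨_, (EReal.coe_toReal (L_lt_top hab hp hR hF).ne (bot_lt_L hF.moment).ne').symm⟩
  have hex : ∀ n : ℕ, ∃ θ : ℝ, ∃ ψ : ℝ → EReal, ψ ∈ SC₀ ∧
      ((l - 1 / ((n : ℝ) + 1) : ℝ) : EReal) ≤ Psi θ ψ F := by
    intro n
    have h1 : ((l - 1 / ((n : ℝ) + 1) : ℝ) : EReal) < L F := by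
      rw [hl, EReal.coe_lt_coe_iff]
      have : 0 < 1 / ((n : ℝ) + 1) := by positivity
      linarith
    simp only [L, lt_iSup_iff] at h1
    obtain ⟨θ, ψ, hψ, h⟩ := h1
    exact ⟨θ, ψ, hψ, h.le⟩
  choose θs ψs hmem hle using hex
  have hC : ∀ n, ((l - 1 : ℝ) : EReal) ≤ Psi (θs n) (ψs n) F := fun n => by
    refine le_trans ?_ (hle n)
    rw [EReal.coe_le_coe_iff]
    have : 1 / ((n : ℝ) + 1) ≤ 1 := by
      rw [div_le_one (by positivity)]
      linarith [(Nat.cast_nonneg n : (0 : ℝ) ≤ n)]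
    linarith
  have hc : ∀ c' < l, ∀ᶠ n in atTop, (c' : EReal) ≤ Psi (θs n) (ψs n) F := fun c' hc' => by
    have h1 : Tendsto (fun n : ℕ => l - 1 / ((n : ℝ) + 1)) atTop (𝓝 (l - 0)) :=
      tendsto_const_nhds.sub tendsto_one_div_add_atTop_nhds_zero_nat
    filter_upwards [h1.eventually (lt_mem_nhds (by linarith : c' < l - 0))] with n hn
    exact le_trans (EReal.coe_le_coe_iff.2 hn.le) (hle n)
  -- A maximizing sequence, with the measures constantly equal to F.
  obtain ⟨-, -, θ, ψ, hψ, -, -, h⟩ := exists_subseq_limit (Fs := fun _ => F) (F := F) hab hp hR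
    (fun _ => hF) (fun G _ => by simp) hmem hC hc
  exact ⟨θ, ψ, isArgmax_iff.2 ⟨hψ, le_antisymm (Psi_le_L F hψ θ) (hl ▸ h)⟩⟩

end Existence

/-! ### Uniqueness of ψ for fixed θ, by midpoint convexity. -/

section Uniqueness

/-- The midpoint of two extended real numbers. -/
noncomputable def mid (v w : EReal) : EReal := ((1 / 2 : ℝ) : EReal) * (v + w)

theorem mid_coe (a b : ℝ) : mid a b = (((a + b) / 2 : ℝ) : EReal) := by
  rw [mid, ← EReal.coe_add, ← EReal.coe_mul]
  congr 1
  ring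

theorem mid_bot_left (w : EReal) : mid ⊥ w = ⊥ := by
  rw [mid, EReal.bot_add, EReal.coe_mul_bot_of_pos (by norm_num)]

theorem mid_bot_right (w : EReal) : mid w ⊥ = ⊥ := by
  rw [mid, EReal.add_bot, EReal.coe_mul_bot_of_pos (by norm_num)]

theorem coe_le_mid {v w : EReal} {a b : ℝ} (ha : (a : EReal) ≤ v) (hb : (b : EReal) ≤ w) :
    (((a + b) / 2 : ℝ) : EReal) ≤ mid v w := by
  rw [← mid_coe]
  exact mul_le_mul_of_nonneg_left (add_le_add ha hb) (by norm_num)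

theorem exists_of_coe_le_mid {v w : EReal} (hv : v ≠ ⊤) (hw : w ≠ ⊤) {c : ℝ}
    (h : (c : EReal) ≤ mid v w) : ∃ a b : ℝ, v = a ∧ w = b ∧ c ≤ (a + b) / 2 := by
  induction v with
  | bot => simp [mid_bot_left] at h
  | top => exact absurd rfl hv
  | coe a =>
    induction w with
    | bot => simp [mid_bot_right] at h
    | top => exact absurd rfl hw
    | coe b => exact ⟨a, b, rfl, rfl, by rwa [mid_coe, EReal.coe_le_coe_iff] at h⟩

theorem mid_mem {ψ χ : ℝ → EReal} (hψ : ψ ∈ SC₀) (hχ : χ ∈ SC₀) :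
    (fun x => mid (ψ x) (χ x)) ∈ SC₀ := by
  have hcont : Continuous fun v : EReal => ((1 / 2 : ℝ) : EReal) * v := by
    refine continuous_iff_continuousAt.2 fun v => ?_
    have h2 : ((1 / 2 : ℝ) : EReal) ≠ 0 := by norm_num
    have h := EReal.continuousAt_mul (p := (((1 / 2 : ℝ) : EReal), v)) (.inl h2) (.inl h2)
      (.inl (EReal.coe_ne_bot _)) (.inl (EReal.coe_ne_top _))
    exact h.comp (f := fun v : EReal => (((1 / 2 : ℝ) : EReal), v)) (by fun_prop)
  refine ⟨⟨?_, fun x hx => ?_, ⟨0, ?_⟩, ?_⟩, fun x => by simp only [hψ.2, hχ.2]⟩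
  · rintro ⟨x, c⟩ hx ⟨y, d⟩ hy s t hs ht hst
    simp only [Set.mem_ofPred_eq, Prod.smul_mk, smul_eq_mul, Prod.mk_add_mk] at hx hy ⊢
    obtain ⟨a, b, ha, hb, hc⟩ := exists_of_coe_le_mid (hψ.1.ne_top x) (hχ.1.ne_top x) hx
    obtain ⟨a', b', ha', hb', hd⟩ := exists_of_coe_le_mid (hψ.1.ne_top y) (hχ.1.ne_top y) hy
    refine le_trans ?_ (coe_le_mid (concave_of_mem hψ ha.ge ha'.ge hs ht hst)
      (concave_of_mem hχ hb.ge hb'.ge hs ht hst))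
    rw [EReal.coe_le_coe_iff]
    nlinarith [mul_le_mul_of_nonneg_left hc hs, mul_le_mul_of_nonneg_left hd ht]
  · have h1 := hψ.1.ne_top x
    have h2 := hχ.1.ne_top x
    obtain ⟨a, b, ha, hb, -⟩ := exists_of_coe_le_mid h1 h2 (c := 0) (by rw [hx]; exact le_top)
    rw [ha, hb, mid_coe] at hx
    exact EReal.coe_ne_top _ hx
  · obtain ⟨a, ha⟩ := exists_coe_eq_zero hψ
    obtain ⟨b, hb⟩ := exists_coe_eq_zero hχ
    rw [ha, hb, mid_coe]
    exact EReal.coe_ne_bot _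
  · refine hcont.comp_upperSemicontinuous (UpperSemicontinuous.add' hψ.1.upperSemicontinuous
      hχ.1.upperSemicontinuous fun x => EReal.continuousAt_add (.inl (hψ.1.ne_top x))
      (.inr (hχ.1.ne_top x))) fun v w hvw => mul_le_mul_of_nonneg_left hvw (by norm_num)

theorem gap_mid (K : ℝ) {v w : EReal} (hv : v ≤ K) (hw : w ≤ K) :
    2 * ((K : EReal) - mid v w).toENNReal
      = ((K : EReal) - v).toENNReal + ((K : EReal) - w).toENNReal := by
  induction v with
  | bot => simp [mid_bot_left]
  | top => simp at hv
  | coe a =>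
    induction w with
    | bot => simp [mid_bot_right]
    | top => simp at hw
    | coe b =>
      rw [EReal.coe_le_coe_iff] at hv hw
      rw [mid_coe, ← EReal.coe_sub, ← EReal.coe_sub, ← EReal.coe_sub]
      simp only [EReal.real_coe_toENNReal]
      rw [← ENNReal.ofReal_add (by linarith) (by linarith), ← ENNReal.ofReal_ofNat,
        ← ENNReal.ofReal_mul (by norm_num)]
      congr 1
      ring

theorem two_mul_exp_half_le (a b : ℝ) : 2 * Real.exp ((a + b) / 2) ≤ Real.exp a + Real.exp b ∧
    (2 * Real.exp ((a + b) / 2) = Real.exp a + Real.exp b → a = b) := by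
  have ha : Real.exp a = Real.exp (a / 2) ^ 2 := by rw [← Real.exp_nat_mul]; congr 1; push_cast; ring
  have hb : Real.exp b = Real.exp (b / 2) ^ 2 := by rw [← Real.exp_nat_mul]; congr 1; push_cast; ring
  have hab : Real.exp ((a + b) / 2) = Real.exp (a / 2) * Real.exp (b / 2) := by
    rw [← Real.exp_add]; congr 1; ring
  rw [ha, hb, hab]
  refine ⟨by nlinarith [sq_nonneg (Real.exp (a / 2) - Real.exp (b / 2))], fun h => ?_⟩
  have h1 : (Real.exp (a / 2) - Real.exp (b / 2)) ^ 2 = 0 := by linarith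
  have h2 := Real.exp_injective (sub_eq_zero.1 (pow_eq_zero_iff two_ne_zero |>.1 h1))
  linarith

theorem two_mul_exp_mid_le {v w : EReal} (hv : v ≠ ⊤) (hw : w ≠ ⊤) :
    2 * (mid v w).exp ≤ v.exp + w.exp ∧ (2 * (mid v w).exp = v.exp + w.exp → v = w) := by
  induction v with
  | bot => simp [mid_bot_left, eq_comm]
  | top => simp at hv
  | coe a =>
    induction w with
    | bot => simp [mid_bot_right, Real.exp_pos]
    | top => simp at hw
    | coe b =>
      obtain ⟨h1, h2⟩ := two_mul_exp_half_le a b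
      have e1 : 2 * (mid a b).exp = ENNReal.ofReal (2 * Real.exp ((a + b) / 2)) := by
        rw [mid_coe, EReal.exp_coe, ENNReal.ofReal_mul (by norm_num), ENNReal.ofReal_ofNat]
      have e2 : (a : EReal).exp + (b : EReal).exp = ENNReal.ofReal (Real.exp a + Real.exp b) := by
        rw [EReal.exp_coe, EReal.exp_coe, ENNReal.ofReal_add (by positivity) (by positivity)]
      rw [e1, e2]
      refine ⟨ENNReal.ofReal_le_ofReal h1, fun h => ?_⟩
      rw [ENNReal.ofReal_eq_ofReal_iff (by positivity) (by positivity)] at h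
      rw [h2 h]

/-- If ψ were finite only at 0, a set of positive mass avoiding θ would make the cost infinite. Such
functions must be excluded because their value at 0 is invisible almost everywhere. -/
theorem exists_ne_zero_bot_lt {F : Measure ℝ} [IsProbabilityMeasure F] {a b p R : ℝ}
    (hab : a < b) (hp : 0 < p) (hF : Spread a b p R F) {ψ : ℝ → EReal} (hψ : ψ ∈ SC₀) {θ : ℝ}
    (h : ⊥ < Psi θ ψ F) : ∃ x, x ≠ 0 ∧ ⊥ < ψ x := by
  by_contra! hbot
  obtain ⟨M, hM⟩ := exists_coe_eq_zero hψ
  have hside : ∃ S : Set ℝ, MeasurableSet S ∧ ENNReal.ofReal p ≤ F S ∧ θ ∉ S := by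
    rcases le_total θ b with h | h
    · exact ⟨_, measurableSet_Ioi, hF.right, by simpa using h⟩
    · exact ⟨_, measurableSet_Iio, hF.left, by simpa using hab.le.trans h⟩
  obtain ⟨S, hS, hpS, hθ⟩ := hside
  have h1 : cost M θ ψ F = ⊤ := by
    refine top_le_iff.1 (le_trans ?_ (self_le_add_right _ _))
    have hS0 : F S ≠ 0 := (lt_of_lt_of_le (ENNReal.ofReal_pos.2 hp) hpS).ne'
    calc (⊤ : ℝ≥0∞) = ∫⁻ _ in S, ⊤ ∂F := by simp [ENNReal.top_mul hS0]
      _ ≤ ∫⁻ x in S, ((M : EReal) - ψ (x - θ)).toENNReal ∂F := by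
          refine setLIntegral_mono' hS fun x hx => ?_
          have hx0 : x - θ ≠ 0 := sub_ne_zero.2 fun h => hθ (h ▸ hx)
          simp [le_bot_iff.1 (hbot _ hx0)]
      _ ≤ _ := setLIntegral_le_lintegral _ _
  rw [Psi_eq hψ hM.le, h1] at h
  simp at h

/-- Members of the class are determined by their values almost everywhere, provided that
the domain contains a point other than the origin. -/
theorem le_of_ae_eq {ψ χ : ℝ → EReal} (hψ : ψ ∈ SC₀) (hχ : χ ∈ SC₀) (h : ψ =ᵐ[volume] χ)
    (hdom : ∃ x, x ≠ 0 ∧ ⊥ < ψ x) (x : ℝ) : ψ x ≤ χ x := by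
  by_contra! hlt
  -- near `x` and closer to the origin, `ψ` exceeds a level that `χ` does not reach
  obtain ⟨c, hc1, hc2⟩ := EReal.lt_iff_exists_real_btwn.1 hlt
  have hU : ∀ᶠ y in 𝓝 x, χ y < c := hχ.1.upperSemicontinuous x c hc1
  have hnull : volume {y | ¬ ψ y = χ y} = 0 := ae_iff.1 h
  suffices h : ∃ V : Set ℝ, IsOpen V ∧ V.Nonempty ∧ ∀ y ∈ V, χ y < c ∧ (c : EReal) < ψ y by
    obtain ⟨V, hV, hne, hVy⟩ := h
    refine (hV.measure_pos volume hne).ne' (measure_mono_null (fun y hy => ?_) hnull)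
    exact ((hVy y hy).1.trans (hVy y hy).2).ne'
  obtain ⟨ε, hε, hball⟩ := Metric.eventually_nhds_iff.1 hU
  rcases eq_or_ne x 0 with rfl | hx
  -- No point is closer to the origin than the origin itself, so the open set comes from concavity
  -- along the segment from 0 to a second point z of the domain.
  · obtain ⟨z, hz, hzb⟩ := hdom
    obtain ⟨d, hcd, hd⟩ := EReal.lt_iff_exists_real_btwn.1 hc2
    obtain ⟨b, -, hb⟩ := EReal.lt_iff_exists_real_btwn.1 hzb
    rw [EReal.coe_lt_coe_iff] at hcd
    have hcont : Continuous fun t : ℝ => (1 - t) * d + t * b := by fun_prop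
    have h1 : ∀ᶠ t in 𝓝[>] (0 : ℝ), c < (1 - t) * d + t * b :=
      (hcont.tendsto' 0 d (by simp)).eventually (lt_mem_nhds hcd) |>.filter_mono nhdsWithin_le_nhds
    obtain ⟨t, ⟨ht1, ht⟩, ht0⟩ := (h1.and (nhdsWithin_le_nhds (Iio_mem_nhds one_pos))
      |>.and self_mem_nhdsWithin).exists
    have ht0 : 0 < t := ht0
    have ht : t < 1 := ht
    have h2 := concave_of_mem hψ hd.le hb.le (s := 1 - t) (t := t) (by linarith) ht0.le (by ring)
    rw [mul_zero, zero_add] at h2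
    have hz0 : 0 < |t * z| := by positivity
    refine ⟨Set.Ioo 0 (min ε |t * z|), isOpen_Ioo, Set.nonempty_Ioo.2 (lt_min hε hz0),
      fun y hy => ⟨hball ?_, ?_⟩⟩
    · rw [Real.dist_eq, sub_zero, abs_of_pos hy.1]
      exact hy.2.trans_le (min_le_left _ _)
    · refine (EReal.coe_lt_coe_iff.2 ht1).trans_le (h2.trans (anti_of_mem hψ ?_))
      rw [abs_of_pos hy.1]
      exact hy.2.le.trans (min_le_right _ _)
  · have hopen : IsOpen (Metric.ball x ε ∩ {y | |y| < |x|}) :=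
      Metric.isOpen_ball.inter (isOpen_lt continuous_abs continuous_const)
    refine ⟨_, hopen, ?_, fun y hy => ⟨hball hy.1, hc2.trans_le (anti_of_mem hψ hy.2.le)⟩⟩
    have h1 : Tendsto (fun t : ℝ => t * x) (𝓝[<] 1) (𝓝 x) := by
      have : Continuous fun t : ℝ => t * x := by fun_prop
      exact (this.tendsto' 1 x (one_mul x)).mono_left nhdsWithin_le_nhds
    obtain ⟨t, ⟨ht1, ht⟩, ht0⟩ := ((h1.eventually (Metric.ball_mem_nhds x hε)).and
      self_mem_nhdsWithin |>.and (nhdsWithin_le_nhds (Ioi_mem_nhds one_pos))).exists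
    have ht0 : 0 < t := ht0
    have ht : t < 1 := ht
    refine ⟨t * x, ht1, ?_⟩
    rw [Set.mem_ofPred_eq, abs_mul, abs_of_pos ht0]
    exact mul_lt_of_lt_one_left (abs_pos.2 hx) ht

/-- The gap is affine in ψ and the exponential strictly convex, so the midpoint of two distinct
maximizers with the same θ would have a smaller cost. -/
theorem isArgmax_unique {F : Measure ℝ} [IsProbabilityMeasure F] {a b p R : ℝ} (hab : a < b)
    (hp : 0 < p) (hF : Spread a b p R F) {θ : ℝ} {ψ χ : ℝ → EReal}
    (hψ : IsArgmax F θ ψ) (hχ : IsArgmax F θ χ) : ψ = χ := by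
  obtain ⟨hψm, hψL⟩ := isArgmax_iff.1 hψ
  obtain ⟨hχm, hχL⟩ := isArgmax_iff.1 hχ
  obtain ⟨M, hM⟩ := exists_coe_eq_zero hψm
  obtain ⟨N, hN⟩ := exists_coe_eq_zero hχm
  set K := max M N with hK
  have hψK : ψ 0 ≤ K := by rw [hM]; exact_mod_cast le_max_left _ _
  have hχK : χ 0 ≤ K := by rw [hN]; exact_mod_cast le_max_right _ _
  have hψK' : ∀ x, ψ x ≤ K := fun x => (le_zero_of_mem hψm x).trans hψK
  have hχK' : ∀ x, χ x ≤ K := fun x => (le_zero_of_mem hχm x).trans hχK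
  have hm := mid_mem hψm hχm
  have hmK : mid (ψ 0) (χ 0) ≤ K := by
    rw [hM, hN, mid_coe, EReal.coe_le_coe_iff]
    linarith [le_max_left M N, le_max_right M N]
  have hL := bot_lt_L (F := F) hF.moment
  obtain ⟨l, hl⟩ : ∃ l : ℝ, L F = l := ⟨_, (EReal.coe_toReal
    (fun h => by
      have := Psi_le_apply_zero (F := F) hψm θ
      rw [hψL, h, hM] at this
      simp at this) hL.ne').symm⟩
  have hcost : ∀ {ξ : ℝ → EReal}, ξ ∈ SC₀ → ξ 0 ≤ K →
      (Psi θ ξ F = L F ↔ cost K θ ξ F ≤ ENNReal.ofReal (K - l)) := by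
    intro ξ hξ hξK
    have hlK : l ≤ K := by
      have := (le_Psi_iff hψm hψK).1 (hl ▸ hψL.ge)
      exact this.1
    rw [le_antisymm_iff, and_iff_right (Psi_le_L F hξ θ), hl, le_Psi_iff hξ hξK,
      and_iff_right hlK]
  have hmin : ∀ {ξ : ℝ → EReal}, ξ ∈ SC₀ → ξ 0 ≤ K → ENNReal.ofReal (K - l) ≤ cost K θ ξ F := by
    intro ξ hξ hξK
    have h := Psi_le_L F hξ θ
    rw [Psi_eq hξ hξK, hl] at h
    by_contra! hlt
    obtain ⟨r, hr1, hr2⟩ := exists_between hlt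
    lift r to NNReal using (hr2.trans_le le_top).ne
    have h1 : (((K - r : ℝ)) : EReal) ≤ (l : EReal) :=
      le_trans (coe_le_sub_iff.2 ⟨by linarith [r.coe_nonneg], by simpa using hr1.le⟩) h
    rw [EReal.coe_le_coe_iff] at h1
    rw [← ENNReal.ofReal_coe_nnreal, ENNReal.ofReal_lt_ofReal_iff'] at hr2
    linarith
  have hψc := le_antisymm ((hcost hψm hψK).1 hψL) (hmin hψm hψK)
  have hχc := le_antisymm ((hcost hχm hχK).1 hχL) (hmin hχm hχK)
  have hmc := hmin hm hmK
  have hgap : 2 * ∫⁻ x, ((K : EReal) - mid (ψ (x - θ)) (χ (x - θ))).toENNReal ∂F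
      = ∫⁻ x, ((K : EReal) - ψ (x - θ)).toENNReal ∂F
        + ∫⁻ x, ((K : EReal) - χ (x - θ)).toENNReal ∂F := by
    rw [← lintegral_const_mul _ (measurable_gap hm K θ), ← lintegral_add_left (measurable_gap hψm K θ)]
    exact lintegral_congr fun x => gap_mid K (hψK' _) (hχK' _)
  -- The midpoint costs no less than the optimum; cancelling the gap integrals, which are finite,
  -- reverses the pointwise convexity inequality under the integral.
  have hexp : ∫⁻ x, (ψ x).exp + (χ x).exp ≤ ∫⁻ x, 2 * (mid (ψ x) (χ x)).exp := by
    rw [lintegral_const_mul _ (measurable_exp_of_mem hm),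
      lintegral_add_left (measurable_exp_of_mem hψm)]
    have h2 : cost K θ ψ F + cost K θ χ F ≤ 2 * cost K θ (fun x => mid (ψ x) (χ x)) F := by
      rw [hψc, hχc, ← two_mul]
      gcongr
    have hfin : ∀ {ξ : ℝ → EReal}, cost K θ ξ F = ENNReal.ofReal (K - l) →
        ∫⁻ x, ((K : EReal) - ξ (x - θ)).toENNReal ∂F ≠ ⊤ := fun h =>
      ne_top_of_le_ne_top (h ▸ ENNReal.ofReal_ne_top) (self_le_add_right _ _)
    simp only [cost] at h2
    rw [mul_add, hgap, add_add_add_comm] at h2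
    exact (ENNReal.add_le_add_iff_left (ENNReal.add_ne_top.2 ⟨hfin hψc, hfin hχc⟩)).1 h2
  have hae : (fun x => 2 * (mid (ψ x) (χ x)).exp) =ᵐ[volume] fun x => (ψ x).exp + (χ x).exp := by
    have hle : ∀ x, 2 * (mid (ψ x) (χ x)).exp ≤ (ψ x).exp + (χ x).exp := fun x =>
      (two_mul_exp_mid_le (hψm.1.ne_top x) (hχm.1.ne_top x)).1
    refine ae_eq_of_ae_le_of_lintegral_le (Eventually.of_forall hle) ?_
      ((measurable_exp_of_mem hψm).add
        (measurable_exp_of_mem hχm)).aemeasurable hexp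
    refine ne_top_of_le_ne_top ?_ (lintegral_mono hle)
    rw [lintegral_add_left (measurable_exp_of_mem hψm)]
    exact ENNReal.add_ne_top.2
      ⟨ne_top_of_le_ne_top (hψc ▸ ENNReal.ofReal_ne_top) (self_le_add_left _ _),
        ne_top_of_le_ne_top (hχc ▸ ENNReal.ofReal_ne_top) (self_le_add_left _ _)⟩
  have heq : ψ =ᵐ[volume] χ := hae.mono fun x hx =>
    (two_mul_exp_mid_le (hψm.1.ne_top x) (hχm.1.ne_top x)).2 hx
  funext x
  exact le_antisymm
    (le_of_ae_eq hψm hχm heq (exists_ne_zero_bot_lt hab hp hF hψm (hψL ▸ hL)) x)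
    (le_of_ae_eq hχm hψm heq.symm (exists_ne_zero_bot_lt hab hp hF hχm (hχL ▸ hL)) x)

end Uniqueness

/-! ### Almost sure properties of the empirical measures. -/

section Sampling

theorem exists_spread_of_conditionA {F : Measure ℝ} [IsProbabilityMeasure F] (hA : ConditionA F) :
    ∃ a b p R : ℝ, a < b ∧ 0 < p ∧ 0 ≤ R ∧ ENNReal.ofReal p < F (Set.Iio a) ∧
      ENNReal.ofReal p < F (Set.Ioi b) ∧ ∫⁻ x, ENNReal.ofReal |x| ∂F < ENNReal.ofReal R := by
  have hpts : ∃ x ∈ F.support, ∃ y ∈ F.support, x < y := by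
    obtain ⟨x, hx⟩ := Measure.nonempty_support (IsProbabilityMeasure.ne_zero F)
    by_contra! h
    have hsub : F.support ⊆ {x} := fun y hy => le_antisymm (h x hx y hy) (h y hy x hx)
    have h0 : F {x}ᶜ = 0 :=
      measure_mono_null (Set.compl_subset_compl.2 hsub) Measure.measure_compl_support
    have h1 : F {x} = 1 := (prob_compl_eq_zero_iff (measurableSet_singleton x)).1 h0
    refine hA.1 x (Measure.ext fun s hs => ?_)
    rw [Measure.dirac_apply' x hs]
    by_cases hxs : x ∈ s
    · rw [Set.indicator_of_mem hxs, Pi.one_apply]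
      exact le_antisymm prob_le_one (h1 ▸ measure_mono (Set.singleton_subset_iff.2 hxs))
    · rw [Set.indicator_of_notMem hxs]
      exact measure_mono_null (Set.subset_compl_singleton_iff.2 hxs) h0
  obtain ⟨x, hx, y, hy, hxy⟩ := hpts
  -- The points cutting [x, y] into thirds leave a gap with a support point on either side.
  have hl : 0 < F (Set.Iio ((2 * x + y) / 3)) :=
    (Measure.mem_support_iff_forall x).1 hx _ (Iio_mem_nhds (by linarith))
  have hr : 0 < F (Set.Ioi ((x + 2 * y) / 3)) :=
    (Measure.mem_support_iff_forall y).1 hy _ (Ioi_mem_nhds (by linarith))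
  obtain ⟨q, hq0, hq⟩ := exists_between (lt_min hl hr)
  have hq' : ENNReal.ofReal q.toReal = q := ENNReal.ofReal_toReal (hq.trans_le le_top).ne
  have hm := hA.2.lintegral_lt_top
  refine ⟨(2 * x + y) / 3, (x + 2 * y) / 3, q.toReal,
    (∫⁻ x, ENNReal.ofReal |x| ∂F).toReal + 1, by linarith,
    ENNReal.toReal_pos hq0.ne' (hq.trans_le le_top).ne, by positivity, ?_, ?_, ?_⟩
  · rw [hq']; exact hq.trans_le (min_le_left _ _)
  · rw [hq']; exact hq.trans_le (min_le_right _ _)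
  · rw [ENNReal.ofReal_add ENNReal.toReal_nonneg zero_le_one, ENNReal.ofReal_toReal hm.ne]
    exact ENNReal.lt_add_right hm.ne (by simp)

theorem lintegral_empirical (x : ℕ → ℝ) (n : ℕ) (h : ℝ → ℝ≥0∞) :
    ∫⁻ y, h y ∂(empirical x n) = (n : ℝ≥0∞)⁻¹ * ∑ i ∈ Finset.range n, h (x i) := by
  simp [empirical, lintegral_finsetSum_measure]

theorem isProbabilityMeasure_empirical (x : ℕ → ℝ) {n : ℕ} (hn : n ≠ 0) :
    IsProbabilityMeasure (empirical x n) := by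
  constructor
  rw [← lintegral_one, lintegral_empirical]
  simp [ENNReal.inv_mul_cancel (Nat.cast_ne_zero.2 hn : (n : ℝ≥0∞) ≠ 0) (ENNReal.natCast_ne_top n)]

variable {Ω : Type*} [MeasurableSpace Ω] {P : Measure Ω} {F₀ : Measure ℝ} {X : ℕ → Ω → ℝ}

/-- The strong law of large numbers for the integrals of a nonnegative function with respect to
the empirical measures. -/
theorem ae_tendsto_lintegral_empirical (hlaw : ∀ i, HasLaw (X i) F₀ P) (hindep : iIndepFun X P)
    {h : ℝ → ℝ≥0∞} (hh : Measurable h) (hfin : ∫⁻ x, h x ∂F₀ ≠ ⊤) :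
    ∀ᵐ ω ∂P, Tendsto (fun n => ∫⁻ x, h x ∂(empirical (fun i => X i ω) n)) atTop
      (𝓝 (∫⁻ x, h x ∂F₀)) := by
  have hr : Measurable fun x => (h x).toReal := hh.ennreal_toReal
  have hint : Integrable (fun x => (h x).toReal) F₀ := integrable_toReal_of_lintegral_ne_top hh.aemeasurable hfin
  have hlt : ∀ᵐ x ∂F₀, h x < ⊤ := ae_lt_top hh hfin
  have hE : ∫ x, (h x).toReal ∂F₀ = (∫⁻ x, h x ∂F₀).toReal := integral_toReal hh.aemeasurable hlt
  have h0 : Integrable (fun ω => (h (X 0 ω)).toReal) P := by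
    rw [← (hlaw 0).map_eq] at hint
    exact hint.comp_aemeasurable (hlaw 0).aemeasurable
  have hE0 : ∫ ω, (h (X 0 ω)).toReal ∂P = ∫ x, (h x).toReal ∂F₀ := by
    rw [← (hlaw 0).map_eq, integral_map (hlaw 0).aemeasurable hr.aestronglyMeasurable]
  have hslln := strong_law_ae_real (fun i ω => (h (X i ω)).toReal) h0
    (fun i j hij => (hindep.indepFun hij).comp hr hr) fun i =>
      (show IdentDistrib (X i) (X 0) P P from ⟨(hlaw i).aemeasurable, (hlaw 0).aemeasurable, by
        rw [(hlaw i).map_eq, (hlaw 0).map_eq]⟩).comp hr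
  -- The real-valued strong law loses infinite values of h, but almost surely no sample point meets
  -- them.
  have hall : ∀ᵐ ω ∂P, ∀ i, h (X i ω) < ⊤ := ae_all_iff.2 fun i => by
    rw [← (hlaw i).map_eq] at hlt
    exact ae_of_ae_map (hlaw i).aemeasurable hlt
  filter_upwards [hslln, hall] with ω h1 h2
  rw [hE0, hE] at h1
  have h3 := (ENNReal.continuous_ofReal.tendsto _).comp h1
  rw [ENNReal.ofReal_toReal hfin] at h3
  refine h3.congr' ?_
  filter_upwards [eventually_gt_atTop 0] with n hn
  have hn' : (0 : ℝ) < n := by exact_mod_cast hn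
  rw [lintegral_empirical, Function.comp_apply, div_eq_inv_mul,
    ENNReal.ofReal_mul (by positivity), ENNReal.ofReal_inv_of_pos hn', ENNReal.ofReal_natCast,
    ENNReal.ofReal_sum_of_nonneg fun i _ => ENNReal.toReal_nonneg]
  congr 1
  exact Finset.sum_congr rfl fun i _ => ENNReal.ofReal_toReal (h2 i).ne

/-- Finite unions of sets from a countable basis form a countable family, so the strong law holds on
all of them simultaneously; every open set is approximated in mass from inside by such unions. -/
theorem ae_lowerWeak_empirical [IsProbabilityMeasure F₀]
    (hlaw : ∀ i, HasLaw (X i) F₀ P) (hindep : iIndepFun X P) :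
    ∀ᵐ ω ∂P, LowerWeak (fun n => empirical (fun i => X i ω) n) F₀ := by
  let 𝓑 := TopologicalSpace.countableBasis ℝ
  have : Countable 𝓑 := (TopologicalSpace.countable_countableBasis ℝ).to_subtype
  have hopen : ∀ S : Finset 𝓑, IsOpen (⋃ B ∈ S, (B : Set ℝ)) := fun S =>
    isOpen_biUnion fun B _ => TopologicalSpace.isOpen_of_mem_countableBasis B.2
  have h1 : ∀ᵐ ω ∂P, ∀ S : Finset 𝓑, Tendsto
      (fun n => empirical (fun i => X i ω) n (⋃ B ∈ S, (B : Set ℝ))) atTop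
      (𝓝 (F₀ (⋃ B ∈ S, (B : Set ℝ)))) := by
    refine ae_all_iff.2 fun S => ?_
    have hm := (hopen S).measurableSet
    have := ae_tendsto_lintegral_empirical hlaw hindep
      (h := (⋃ B ∈ S, (B : Set ℝ)).indicator 1) (measurable_one.indicator hm)
      (by rw [lintegral_indicator_one hm]; exact measure_ne_top _ _)
    simpa only [lintegral_indicator_one hm] using this
  filter_upwards [h1] with ω hω G hG
  have hGU : G = ⋃ B : {B : 𝓑 // (B : Set ℝ) ⊆ G}, ((B : 𝓑) : Set ℝ) := by
    refine Set.Subset.antisymm (fun x hx => ?_) (Set.iUnion_subset fun B => B.2)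
    obtain ⟨B, hB, hxB, hBG⟩ :=
      (TopologicalSpace.isBasis_countableBasis ℝ).exists_subset_of_mem_open hx hG
    exact Set.mem_iUnion.2 ⟨⟨⟨B, hB⟩, hBG⟩, hxB⟩
  have hsup : F₀ G = ⨆ S : Finset {B : 𝓑 // (B : Set ℝ) ⊆ G}, F₀ (⋃ B ∈ S, ((B : 𝓑) : Set ℝ)) := by
    conv_lhs => rw [hGU]
    rw [Set.iUnion_eq_iUnion_finset]
    refine Directed.measure_iUnion (directed_of_isDirected_le fun S T hST => ?_)
    exact Set.biUnion_subset_biUnion_left hST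
  rw [hsup]
  refine iSup_le fun S => ?_
  have e : (⋃ B ∈ S, ((B : 𝓑) : Set ℝ)) = ⋃ B ∈ S.map (Function.Embedding.subtype _), (B : Set ℝ) := by
    rw [← Finset.set_biUnion_coe, ← Finset.set_biUnion_coe, Finset.coe_map, Set.biUnion_image]
    rfl
  rw [e, ← (hω (S.map (Function.Embedding.subtype _))).liminf_eq, ← e]
  refine liminf_le_liminf (Eventually.of_forall fun n => measure_mono ?_)
  exact Set.iUnion₂_subset fun B _ => B.2

theorem ae_tendsto_Psi_empirical [IsProbabilityMeasure F₀]
    (hlaw : ∀ i, HasLaw (X i) F₀ P) (hindep : iIndepFun X P)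
    {ψ : ℝ → EReal} (hψ : ψ ∈ SC₀) {θ : ℝ} (h : ⊥ < Psi θ ψ F₀) :
    ∀ᵐ ω ∂P, Tendsto (fun n => Psi θ ψ (empirical (fun i => X i ω) n)) atTop
      (𝓝 (Psi θ ψ F₀)) := by
  obtain ⟨M, hM⟩ := exists_coe_eq_zero hψ
  have hcost : cost M θ ψ F₀ ≠ ⊤ := by
    intro h'
    rw [Psi_eq hψ hM.le, h'] at h
    simp at h
  have hfin := ne_top_of_le_ne_top hcost (self_le_add_right _ _)
  filter_upwards [ae_tendsto_lintegral_empirical hlaw hindep (measurable_gap hψ M θ) hfin] with ω hω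
  have h1 : Tendsto (fun n => cost M θ ψ (empirical (fun i => X i ω) n)) atTop
      (𝓝 (cost M θ ψ F₀)) := hω.add tendsto_const_nhds
  have h2 : Tendsto (fun n => (M : EReal) - ((cost M θ ψ (empirical (fun i => X i ω) n) : ℝ≥0∞) : EReal))
      atTop (𝓝 ((M : EReal) - ((cost M θ ψ F₀ : ℝ≥0∞) : EReal))) := by
    simp_rw [sub_eq_add_neg]
    refine (EReal.continuousAt_add (p := ((M : EReal), -((cost M θ ψ F₀ : ℝ≥0∞) : EReal)))
      (.inl (EReal.coe_ne_top _)) (.inl (EReal.coe_ne_bot _))).tendsto.comp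
      (tendsto_const_nhds.prodMk_nhds ?_)
    exact ((continuous_neg.comp continuous_coe_ennreal_ereal).tendsto _).comp h1
  rw [Psi_eq hψ hM.le]
  refine h2.congr' ?_
  filter_upwards [eventually_ne_atTop 0] with n hn
  have := isProbabilityMeasure_empirical (fun i => X i ω) hn
  rw [Psi_eq hψ hM.le]

theorem ae_eventually_spread_empirical [IsProbabilityMeasure F₀]
    (hlaw : ∀ i, HasLaw (X i) F₀ P) (hindep : iIndepFun X P)
    {a b p R : ℝ} (ha : ENNReal.ofReal p < F₀ (Set.Iio a)) (hb : ENNReal.ofReal p < F₀ (Set.Ioi b))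
    (hR : ∫⁻ x, ENNReal.ofReal |x| ∂F₀ < ENNReal.ofReal R) :
    ∀ᵐ ω ∂P, ∀ᶠ n in atTop, Spread a b p R (empirical (fun i => X i ω) n) := by
  filter_upwards [ae_lowerWeak_empirical hlaw hindep, ae_tendsto_lintegral_empirical hlaw hindep
    (h := fun x => ENNReal.ofReal |x|) (by fun_prop) (hR.trans_le le_top).ne] with ω h1 h2
  filter_upwards [eventually_lt_of_lt_liminf (ha.trans_le (h1 _ isOpen_Iio)),
    eventually_lt_of_lt_liminf (hb.trans_le (h1 _ isOpen_Ioi)), h2.eventually_lt_const hR]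
    with n h3 h4 h5
  exact ⟨h3.le, h4.le, h5.le⟩

end Sampling

/-! ### Passage from ψ to exp ψ. -/

section Functions

variable {ψ : ℝ → EReal}

theorem expOf_nonneg (ψ : ℝ → EReal) (x : ℝ) : 0 ≤ expOf ψ x := ENNReal.toReal_nonneg

theorem expOf_le {x r : ℝ} (h : ψ x ≤ r) : expOf ψ x ≤ Real.exp r := by
  refine ENNReal.toReal_le_of_le_ofReal (Real.exp_pos r).le ?_
  rw [← EReal.exp_coe]
  exact EReal.exp_monotone h

theorem measurable_expOf (hψ : ψ ∈ SC₀) : Measurable (expOf ψ) :=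
  (measurable_exp_of_mem hψ).ennreal_toReal

theorem expOf_eq_zero_iff (hψ : ψ ∈ SC₀) {x : ℝ} : expOf ψ x = 0 ↔ ψ x = ⊥ := by
  rw [expOf, ENNReal.toReal_eq_zero_iff, EReal.exp_eq_zero_iff, EReal.exp_eq_top_iff,
    or_iff_left (hψ.1.ne_top x)]

theorem expOf_anti (hψ : ψ ∈ SC₀) {x y : ℝ} (h : |x| ≤ |y|) : expOf ψ y ≤ expOf ψ x :=
  ENNReal.toReal_mono (by simpa using hψ.1.ne_top x) (EReal.exp_monotone (anti_of_mem hψ h))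

theorem tendsto_expOf (hψ : ψ ∈ SC₀) {ψs : ℕ → ℝ → EReal} {x : ℝ}
    (h : Tendsto (fun n => ψs n x) atTop (𝓝 (ψ x))) :
    Tendsto (fun n => expOf (ψs n) x) atTop (𝓝 (expOf ψ x)) :=
  (ENNReal.tendsto_toReal (by simpa using hψ.1.ne_top x)).comp
    ((ENNReal.continuous_exp.tendsto _).comp h)

theorem ConvergesTo.eventually_lt_apply {ψs : ℕ → ℝ → EReal} (h : ConvergesTo ψs ψ) {x : ℝ}
    {c : EReal} (hc : ψ x < c) : ∀ᶠ n in atTop, ψs n x < c :=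
  (h.eventually_lt x c hc).curry.mono fun _ hn => hn.self_of_nhds

theorem ConvergesTo.tendsto_of_eq_bot {ψs : ℕ → ℝ → EReal} (h : ConvergesTo ψs ψ) {x : ℝ}
    (hx : ψ x = ⊥) : Tendsto (fun n => ψs n x) atTop (𝓝 (ψ x)) :=
  tendsto_order.2 ⟨fun a ha => absurd ha (by simp [hx]), fun _ hc => h.eventually_lt_apply hc⟩

theorem ConvergesTo.limsup_le {ψs : ℕ → ℝ → EReal} (h : ConvergesTo ψs ψ) (x : ℝ) :
    limsup (fun n => ψs n x) atTop ≤ ψ x :=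
  le_of_forall_gt fun c hc => by
    obtain ⟨d, hd, hdc⟩ := exists_between hc
    exact (limsup_le_of_le (by isBoundedDefault)
      ((h.eventually_lt_apply hd).mono fun _ hn => hn.le)).trans_lt hdc

/-- A point outside the interior of the domain is a limit of points where exp ψ vanishes, so
continuity forces it to vanish there too; then the upper bound alone gives convergence. -/
theorem ConvergesTo.tendsto_expOf_of_continuousAt {ψs : ℕ → ℝ → EReal} (h : ConvergesTo ψs ψ)
    (hψ : ψ ∈ SC₀) {x : ℝ} (hx : ContinuousAt (expOf ψ) x) :
    Tendsto (fun n => expOf (ψs n) x) atTop (𝓝 (expOf ψ x)) := by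
  refine tendsto_expOf hψ ?_
  by_cases hint : x ∈ interior (dom ψ)
  · exact h.tendsto x hint
  · refine h.tendsto_of_eq_bot ((expOf_eq_zero_iff hψ).1 ?_)
    rw [interior_eq_compl_closure_compl, Set.notMem_compl_iff] at hint
    have : (𝓝[(dom ψ)ᶜ] x).NeBot := mem_closure_iff_nhdsWithin_neBot.1 hint
    refine tendsto_nhds_unique (l := 𝓝[(dom ψ)ᶜ] x) (hx.tendsto.mono_left nhdsWithin_le_nhds)
      (tendsto_const_nhds.congr' ?_)
    filter_upwards [self_mem_nhdsWithin] with y hy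
    exact ((expOf_eq_zero_iff hψ).2 (by simpa [dom] using hy)).symm

/-- Functions that are nonincreasing in `|x|` and converge pointwise to a continuous function
converge locally uniformly. -/
theorem tendstoLocallyUniformly_of_anti {f : ℕ → ℝ → ℝ} {g : ℝ → ℝ}
    (hf : ∀ᶠ n in atTop, ∀ x y : ℝ, |x| ≤ |y| → f n y ≤ f n x) (hg : Continuous g)
    (h : ∀ x, Tendsto (fun n => f n x) atTop (𝓝 (g x))) :
    TendstoLocallyUniformly f g atTop := by
  have hganti : ∀ x y : ℝ, |x| ≤ |y| → g y ≤ g x := fun x y hxy =>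
    le_of_tendsto_of_tendsto (h y) (h x) (hf.mono fun n hn => hn x y hxy)
  rw [Metric.tendstoLocallyUniformly_iff]
  intro ε hε x
  obtain ⟨ρ, hρ, hρx⟩ := Metric.continuousAt_iff.1 (hg.continuousAt (x := |x|)) (ε / 3) (by positivity)
  have hgabs : ∀ y, g |y| = g y := fun y => le_antisymm (hganti _ _ (by simp)) (hganti _ _ (by simp))
  set u := max (|x| - ρ / 2) 0 with hu
  set v := |x| + ρ / 2 with hv
  have hu0 : 0 ≤ u := le_max_right _ _
  have hv0 : 0 ≤ v := by positivity
  have hclose : ∀ z : ℝ, |z - (|x|)| ≤ ρ / 2 → |g z - g x| < ε / 3 := fun z hz => by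
    have := hρx (x := z) (by rw [Real.dist_eq]; linarith)
    rwa [Real.dist_eq, hgabs] at this
  have hgu : |g u - g x| < ε / 3 := hclose u (by
    rw [abs_le]
    constructor
    · linarith [le_max_left (|x| - ρ / 2) 0]
    · have : u ≤ |x| := max_le (by linarith) (abs_nonneg x)
      linarith)
  have hgv : |g v - g x| < ε / 3 := hclose v (by rw [hv, add_sub_cancel_left, abs_of_pos (by linarith)])
  have hlim : ∀ z, ∀ᶠ n in atTop, |f n z - g z| < ε / 3 := fun z => by
    have := Metric.tendsto_nhds.1 (h z) (ε / 3) (by positivity)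
    simpa only [Real.dist_eq] using this
  refine ⟨Metric.ball x (ρ / 2), Metric.ball_mem_nhds x (by positivity), ?_⟩
  filter_upwards [hf, hlim u, hlim v] with n hn h1 h2 y hy
  rw [Metric.mem_ball, Real.dist_eq] at hy
  have hyx : |(|y| - |x|)| ≤ ρ / 2 := (abs_abs_sub_abs_le_abs_sub y x).trans hy.le
  have hgy := hclose |y| hyx
  rw [hgabs] at hgy
  rw [abs_le] at hyx
  -- Monotonicity squeezes f n y between its values at the two fixed points u and v, where pointwise
  -- convergence is available.
  have h3 : f n y ≤ f n u := hn u y (by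
    rw [abs_of_nonneg hu0]
    exact max_le (by linarith [hyx.1]) (abs_nonneg y))
  have h4 : f n v ≤ f n y := hn y v (by rw [abs_of_nonneg hv0]; linarith [hyx.2])
  rw [Real.dist_eq, abs_lt]
  rw [abs_lt] at hgu hgv h1 h2 hgy
  constructor <;> linarith

end Functions

/-! ### Weighted convergence under an exponential envelope. -/

section Weighted

variable {ψs : ℕ → ℝ → EReal} {ψ : ℝ → EReal} {A B α : ℝ}

theorem weighted_diff_le {χ : ℝ → EReal} {x : ℝ} (hψ : ψ x ≤ ((A - B * |x| : ℝ) : EReal))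
    (hχ : χ x ≤ ((A - B * |x| : ℝ) : EReal)) :
    Real.exp (α * |x|) * |expOf χ x - expOf ψ x| ≤ Real.exp A * Real.exp ((α - B) * |x|) := by
  have h1 : |expOf χ x - expOf ψ x| ≤ Real.exp (A - B * |x|) := by
    rw [abs_le]
    have := expOf_le hψ
    have := expOf_le hχ
    have := expOf_nonneg ψ x
    have := expOf_nonneg χ x
    constructor <;> linarith
  refine (mul_le_mul_of_nonneg_left h1 (Real.exp_pos _).le).trans (le_of_eq ?_)
  rw [← Real.exp_add, ← Real.exp_add]
  congr 1
  ring

theorem tendsto_lintegral_weighted (hα : α < B) (hψ : ψ ∈ SC₀) (hmem : ∀ᶠ n in atTop, ψs n ∈ SC₀)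
    (h : ConvergesTo ψs ψ) (hψA : ∀ x, ψ x ≤ ((A - B * |x| : ℝ) : EReal))
    (hA : ∀ᶠ n in atTop, ∀ x, ψs n x ≤ ((A - B * |x| : ℝ) : EReal)) :
    Tendsto (fun n => ∫⁻ x, ENNReal.ofReal (Real.exp (α * |x|) *
      |expOf (ψs n) x - expOf ψ x|)) atTop (𝓝 0) := by
  have hlim : ∀ᵐ x, Tendsto (fun n => ENNReal.ofReal (Real.exp (α * |x|) *
      |expOf (ψs n) x - expOf ψ x|)) atTop (𝓝 0) := by
    have : ∀ᵐ x, x ∉ frontier (dom ψ) := measure_eq_zero_iff_ae_notMem.1 (volume_frontier_dom hψ)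
    filter_upwards [this] with x hx
    have h1 := tendsto_expOf hψ (h.tendsto_of_notMem_frontier hx)
    have h2 := ((h1.sub_const (expOf ψ x)).abs.const_mul (Real.exp (α * |x|)))
    rw [sub_self, abs_zero, mul_zero] at h2
    have h3 := (ENNReal.continuous_ofReal.tendsto 0).comp h2
    rwa [ENNReal.ofReal_zero] at h3
  have := tendsto_lintegral_filter_of_dominated_convergence (μ := volume) (f := fun _ => 0)
    (fun x => ENNReal.ofReal (Real.exp A * Real.exp ((α - B) * |x|)))
    (hmem.mono fun n hn => ?_) (hA.mono fun n hn => Eventually.of_forall fun x => ?_) ?_ hlim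
  · simpa using this
  · have h1 := measurable_expOf hn
    have h2 := measurable_expOf hψ
    fun_prop
  · exact ENNReal.ofReal_le_ofReal (weighted_diff_le (hψA x) (hn x))
  · exact ((integrable_exp_mul_abs_of_neg (by linarith : α - B < 0)).const_mul _).lintegral_lt_top.ne

theorem tendsto_iSup_weighted (hα : α < B) (hψ : ψ ∈ SC₀) (hmem : ∀ᶠ n in atTop, ψs n ∈ SC₀)
    (h : ConvergesTo ψs ψ) (hψA : ∀ x, ψ x ≤ ((A - B * |x| : ℝ) : EReal))
    (hA : ∀ᶠ n in atTop, ∀ x, ψs n x ≤ ((A - B * |x| : ℝ) : EReal))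
    (hcont : Continuous (expOf ψ)) :
    Tendsto (fun n => ⨆ x, ENNReal.ofReal (Real.exp (α * |x|) *
      |expOf (ψs n) x - expOf ψ x|)) atTop (𝓝 0) := by
  rw [ENNReal.tendsto_nhds_zero]
  intro ε hε
  obtain ⟨δ, hδ, hδε⟩ : ∃ δ : ℝ, 0 < δ ∧ ENNReal.ofReal δ ≤ ε := by
    obtain ⟨q, hq0, hq⟩ := exists_between hε
    exact ⟨q.toReal, ENNReal.toReal_pos hq0.ne' (hq.trans_le le_top).ne,
      (ENNReal.ofReal_toReal (hq.trans_le le_top).ne).trans_le hq.le⟩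
  have htail : Tendsto (fun t : ℝ => Real.exp A * Real.exp ((α - B) * t)) atTop (𝓝 0) := by
    have h1 : Tendsto (fun t : ℝ => (α - B) * t) atTop atBot :=
      tendsto_id.const_mul_atTop_of_neg (by linarith)
    simpa using (Real.tendsto_exp_atBot.comp h1).const_mul (Real.exp A)
  obtain ⟨T, hT⟩ := eventually_atTop.1 (htail.eventually_lt_const hδ)
  have hunif : TendstoUniformlyOn (fun n => expOf (ψs n)) (expOf ψ) atTop (Set.Icc (-T) T) :=
    (tendstoLocallyUniformlyOn_iff_tendstoUniformlyOn_of_compact isCompact_Icc).1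
      (tendstoLocallyUniformly_of_anti (hmem.mono fun n hn x y hxy => expOf_anti hn hxy) hcont
        fun x => h.tendsto_expOf_of_continuousAt hψ hcont.continuousAt).tendstoLocallyUniformlyOn
  -- Beyond T the envelope suffices; within T the weight is at most exp(|α| T), whence the
  -- tolerance. The absolute value covers negative α.
  filter_upwards [hA, Metric.tendstoUniformlyOn_iff.1 hunif (δ / Real.exp (|α| * T)) (by positivity)]
    with n hn1 hn2
  refine iSup_le fun x => (ENNReal.ofReal_le_ofReal ?_).trans hδε
  rcases le_total T |x| with hx | hx
  · exact (weighted_diff_le (hψA x) (hn1 x)).trans (hT _ hx).le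
  · have h1 := hn2 x (abs_le.1 hx)
    rw [Real.dist_eq, abs_sub_comm, lt_div_iff₀ (Real.exp_pos _)] at h1
    refine le_trans ?_ h1.le
    rw [mul_comm]
    have h2 : α * |x| ≤ |α| * T := by
      have := mul_le_mul_of_nonneg_right (le_abs_self α) (abs_nonneg x)
      have := mul_le_mul_of_nonneg_left hx (abs_nonneg α)
      linarith
    gcongr

end Weighted

/-! ### Consistency along an approximating sequence. -/

section Consistency

variable {a b p R : ℝ} {Fs : ℕ → Measure ℝ} {F : Measure ℝ}

/-- The conditions on a sequence of distributions under which the maximizers converge. -/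
structure Approximates (a b p R : ℝ) (θ : ℝ) (ψ : ℝ → EReal) (Fs : ℕ → Measure ℝ)
    (F : Measure ℝ) : Prop where
  prob : ∀ᶠ n in atTop, IsProbabilityMeasure (Fs n)
  spread : ∀ᶠ n in atTop, Spread a b p R (Fs n)
  lowerWeak : LowerWeak Fs F
  tendsto_Psi : Tendsto (fun n => Psi θ ψ (Fs n)) atTop (𝓝 (Psi θ ψ F))

/-- The subsequence `ms` is built in for use in subsequence arguments. The hypotheses hold only
eventually, so the indices are shifted by N before `exists_subseq_limit` is applied. -/
theorem exists_subseq_limit_of_isArgmax [IsProbabilityMeasure F] (hab : a < b) (hp : 0 < p) (hR : 0 ≤ R) {θ : ℝ}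
    {ψ : ℝ → EReal} (hFs : Approximates a b p R θ ψ Fs F) {l : ℝ} (hl : Psi θ ψ F = l)
    (hψ : ψ ∈ SC₀) {θs : ℕ → ℝ} {ψs : ℕ → ℝ → EReal}
    (hmax : ∀ᶠ n in atTop, IsArgmax (Fs n) (θs n) (ψs n)) {ms : ℕ → ℕ}
    (hms : Tendsto ms atTop atTop) {c : ℝ}
    (hc : ∀ c' < c, ∀ᶠ k in atTop, (c' : EReal) ≤ L (Fs (ms k))) :
    ∃ ns : ℕ → ℕ, Tendsto ns atTop atTop ∧ ∃ η, ∃ χ ∈ SC₀,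
      Tendsto (fun k => θs (ms (ns k))) atTop (𝓝 η) ∧
      ConvergesTo (fun k => ψs (ms (ns k))) χ ∧ (c : EReal) ≤ Psi η χ F := by
  have hlow : ∀ᶠ n in atTop, ((l - 1 : ℝ) : EReal) < Psi θ ψ (Fs n) :=
    hFs.tendsto_Psi.eventually_const_lt (by rw [hl, EReal.coe_lt_coe_iff]; linarith)
  obtain ⟨N, hN⟩ := eventually_atTop.1 (hms.eventually
    (hFs.prob.and (hFs.spread.and (hmax.and hlow))))
  have : ∀ k, IsProbabilityMeasure (Fs (ms (k + N))) := fun k => (hN _ (by omega)).1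
  have hsh : Tendsto (fun k => k + N) atTop atTop := tendsto_add_atTop_nat N
  have hPsi : ∀ k, Psi (θs (ms (k + N))) (ψs (ms (k + N))) (Fs (ms (k + N)))
      = L (Fs (ms (k + N))) := fun k => (isArgmax_iff.1 (hN (k + N) (by omega)).2.2.1).2
  obtain ⟨ns, hns, η, χ, hχ, h1, h2, h3⟩ := exists_subseq_limit (Fs := fun k => Fs (ms (k + N)))
    (F := F) (θs := fun k => θs (ms (k + N))) (ψs := fun k => ψs (ms (k + N))) (C := l - 1) (c := c)
    hab hp hR (fun k => (hN _ (by omega)).2.1)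
    (fun G hG => (hFs.lowerWeak G hG).trans
      (liminf_le_liminf_of_le (hms.comp hsh) (u := fun n => Fs n G)))
    (fun k => (hN (k + N) (by omega)).2.2.1.1)
    (fun k => by
      rw [hPsi]
      exact (hN (k + N) (by omega)).2.2.2.le.trans (Psi_le_L _ hψ _))
    (fun c' hc' => (hsh.eventually (hc c' hc')).mono fun k hk => by rwa [hPsi])
  exact ⟨fun k => ns k + N, hsh.comp hns.tendsto_atTop, η, χ, hχ, h1, h2, h3⟩

variable {θ : ℝ} {ψ : ℝ → EReal}

theorem Approximates.eventually_exists_isArgmax (hab : a < b) (hp : 0 < p) (hR : 0 ≤ R)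
    (hFs : Approximates a b p R θ ψ Fs F) : ∀ᶠ n in atTop, ∃ η χ, IsArgmax (Fs n) η χ := by
  filter_upwards [hFs.prob, hFs.spread] with n h1 h2
  exact exists_isArgmax hab hp hR h2

theorem Approximates.eventually_le_L (hFs : Approximates a b p R θ ψ Fs F)
    (hψ : IsArgmax F θ ψ) {c : EReal} (hc : c < L F) : ∀ᶠ n in atTop, c < L (Fs n) := by
  obtain ⟨hψm, hψL⟩ := isArgmax_iff.1 hψ
  rw [← hψL] at hc
  exact (hFs.tendsto_Psi.eventually_const_lt hc).mono fun n hn => hn.trans_le (Psi_le_L _ hψm _)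

theorem Approximates.tendsto_L [IsProbabilityMeasure F] (hab : a < b) (hp : 0 < p) (hR : 0 ≤ R)
    (hFs : Approximates a b p R θ ψ Fs F) (hψ : IsArgmax F θ ψ) {l : ℝ} (hl : L F = l) :
    Tendsto (fun n => L (Fs n)) atTop (𝓝 (L F)) := by
  refine tendsto_order.2 ⟨fun c hc => hFs.eventually_le_L hψ hc, fun c hc => ?_⟩
  obtain ⟨hψm, hψL⟩ := isArgmax_iff.1 hψ
  by_contra hnot
  obtain ⟨ms, hms, hge⟩ := exists_seq_forall_of_frequently (not_eventually.1 hnot)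
  obtain ⟨d, hld, hdc⟩ := EReal.lt_iff_exists_real_btwn.1 hc
  have hex : ∀ n, ∃ q : ℝ × (ℝ → EReal), (∃ η χ, IsArgmax (Fs n) η χ) → IsArgmax (Fs n) q.1 q.2 := by
    intro n
    by_cases h : ∃ η χ, IsArgmax (Fs n) η χ
    · obtain ⟨η, χ, h⟩ := h
      exact ⟨(η, χ), fun _ => h⟩
    · exact ⟨(0, ψ), fun h' => absurd h' h⟩
  choose q hq using hex
  obtain ⟨-, -, η, χ, hχ, -, -, h⟩ := exists_subseq_limit_of_isArgmax hab hp hR hFs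
    (hψL.trans hl) hψm (θs := fun n => (q n).1) (ψs := fun n => (q n).2)
    ((hFs.eventually_exists_isArgmax hab hp hR).mono fun n hn => hq n hn) hms (c := d)
    fun c' hc' => Eventually.of_forall fun k =>
      ((EReal.coe_lt_coe_iff.2 hc').le.trans hdc.le).trans (not_lt.1 (hge k))
  exact absurd (h.trans (Psi_le_L F hχ η)) (not_le.2 hld)

/-- Consistency of the maximizers. -/
theorem Approximates.tendsto_isArgmax [IsProbabilityMeasure F] (hab : a < b) (hp : 0 < p) (hR : 0 ≤ R)
    (hFs : Approximates a b p R θ ψ Fs F) (hψ : IsArgmax F θ ψ)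
    (huniq : ∀ η χ, IsArgmax F η χ → η = θ ∧ χ = ψ) {l : ℝ} (hl : L F = l)
    {θs : ℕ → ℝ} {ψs : ℕ → ℝ → EReal} (hmax : ∀ᶠ n in atTop, IsArgmax (Fs n) (θs n) (ψs n)) :
    Tendsto θs atTop (𝓝 θ) ∧ ConvergesTo ψs ψ := by
  obtain ⟨hψm, hψL⟩ := isArgmax_iff.1 hψ
  have key : ∀ ms : ℕ → ℕ, Tendsto ms atTop atTop → ∃ ns : ℕ → ℕ, Tendsto ns atTop atTop ∧
      Tendsto (fun k => θs (ms (ns k))) atTop (𝓝 θ) ∧ ConvergesTo (fun k => ψs (ms (ns k))) ψ := by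
    intro ms hms
    obtain ⟨ns, hns, η, χ, hχ, h1, h2, h3⟩ := exists_subseq_limit_of_isArgmax hab hp hR hFs
      (hψL.trans hl) hψm hmax hms (c := l) fun c' hc' =>
        (hms.eventually (hFs.eventually_le_L hψ (c := c')
          (by rwa [hl, EReal.coe_lt_coe_iff]))).mono fun k hk => hk.le
    obtain ⟨rfl, rfl⟩ := huniq η χ (isArgmax_iff.2 ⟨hχ, le_antisymm (Psi_le_L F hχ η) (hl ▸ h3)⟩)
    exact ⟨ns, hns, h1, h2⟩
  refine ⟨tendsto_of_subseq_tendsto fun ms hms => ?_, ⟨fun x c hc => ?_, fun x hx =>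
    tendsto_of_subseq_tendsto fun ms hms => ?_⟩⟩
  · obtain ⟨ns, -, h, -⟩ := key ms hms
    exact ⟨ns, h⟩
  · by_contra hnot
    -- A failure of the locally uniform bound yields indices tending to infinity together with
    -- points tending to x, and `key` is applied to those indices.
    obtain ⟨q, hq, hge⟩ := exists_seq_forall_of_frequently (not_eventually.1 hnot)
    obtain ⟨ns, hns, -, h⟩ := key (fun k => (q k).1) (tendsto_fst.comp hq)
    have h1 : Tendsto (fun k => (k, (q (ns k)).2)) atTop (atTop ×ˢ 𝓝 x) :=
      tendsto_id.prodMk (tendsto_snd.comp (hq.comp hns))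
    obtain ⟨k, hk⟩ := (h1.eventually (h.eventually_lt x c hc)).exists
    exact hge (ns k) hk
  · obtain ⟨ns, -, -, h⟩ := key ms hms
    exact ⟨ns, h.tendsto x hx⟩

end Consistency

end SymLogConcave

/-! ### The theorem. -/

open SymLogConcave in
theorem mainTheorem6 {Ω : Type*} [MeasurableSpace Ω] (P : Measure Ω) [IsProbabilityMeasure P]
    (F₀ : Measure ℝ) [IsProbabilityMeasure F₀] (X : ℕ → Ω → ℝ)
    (hlaw : ∀ i, HasLaw (X i) F₀ P) (hindep : iIndepFun X P)
    (hA : SymLogConcave.ConditionA F₀) (hB : SymLogConcave.ConditionB F₀) :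
    ⊥ < SymLogConcave.L F₀ ∧ SymLogConcave.L F₀ < ⊤ ∧
    ∃ (θs : ℝ) (ψs : ℝ → EReal),
      SymLogConcave.IsArgmax F₀ θs ψs ∧
      (∀ θ ψ, SymLogConcave.IsArgmax F₀ θ ψ → θ = θs ∧ ψ = ψs) ∧
      ∃ α : ℝ, 0 < α ∧ ∀ᵐ ω ∂P,
        Tendsto (fun n => SymLogConcave.L (SymLogConcave.empirical (fun i => X i ω) n)) atTop
          (𝓝 (SymLogConcave.L F₀)) ∧
        (∀ᶠ n in atTop, ∃ θ ψ,
          SymLogConcave.IsArgmax (SymLogConcave.empirical (fun i => X i ω) n) θ ψ) ∧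
        ∀ (θhat : ℕ → ℝ) (ψhat : ℕ → ℝ → EReal),
          (∀ᶠ n in atTop,
            SymLogConcave.IsArgmax (SymLogConcave.empirical (fun i => X i ω) n)
              (θhat n) (ψhat n)) →
          Tendsto θhat atTop (𝓝 θs) ∧
          (∀ x ∈ interior (SymLogConcave.dom ψs),
            Tendsto (fun n => ψhat n x) atTop (𝓝 (ψs x))) ∧
          (∀ x, limsup (fun n => ψhat n x) atTop ≤ ψs x) ∧
          (∀ x, ContinuousAt (SymLogConcave.expOf ψs) x →
            Tendsto (fun n => SymLogConcave.expOf (ψhat n) x) atTop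
              (𝓝 (SymLogConcave.expOf ψs x))) ∧
          (∀ α₁ < α,
            Tendsto (fun n => ∫⁻ x, ENNReal.ofReal (Real.exp (α₁ * |x|) *
              |SymLogConcave.expOf (ψhat n) x - SymLogConcave.expOf ψs x|)) atTop (𝓝 0) ∧
            (Continuous (SymLogConcave.expOf ψs) →
              Tendsto (fun n => ⨆ x, ENNReal.ofReal (Real.exp (α₁ * |x|) *
                |SymLogConcave.expOf (ψhat n) x - SymLogConcave.expOf ψs x|)) atTop (𝓝 0))) := by
  obtain ⟨a, b, p, R, hab, hp, hR, ha, hb, hm⟩ := exists_spread_of_conditionA hA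
  have hsp : Spread a b p R F₀ := ⟨ha.le, hb.le, hm.le⟩
  have hbot := bot_lt_L (F := F₀) hm.le
  have htop := L_lt_top hab hp hR hsp
  obtain ⟨l, hl⟩ : ∃ l : ℝ, L F₀ = l := ⟨_, (EReal.coe_toReal htop.ne hbot.ne').symm⟩
  obtain ⟨θs, ψs, hmax⟩ := exists_isArgmax hab hp hR hsp
  obtain ⟨hψ, hψL⟩ := isArgmax_iff.1 hmax
  have huniq : ∀ θ ψ, IsArgmax F₀ θ ψ → θ = θs ∧ ψ = ψs := by
    intro θ ψ h
    obtain rfl := hB θ ψ θs ψs h hmax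
    exact ⟨rfl, isArgmax_unique hab hp hsp h hmax⟩
  -- Any level below L(F₀) would do, since the empirical maxima eventually exceed it; the envelope
  -- obtained is independent of n and of ω.
  obtain ⟨K, A, α, T, hα, henv⟩ := exists_uniform_bounds hab hp hR (l - 1)
  refine ⟨hbot, htop, θs, ψs, hmax, huniq, α, hα, ?_⟩
  filter_upwards [ae_eventually_spread_empirical hlaw hindep ha hb hm,
    ae_lowerWeak_empirical hlaw hindep,
    ae_tendsto_Psi_empirical hlaw hindep hψ (hψL ▸ hbot)] with ω h1 h2 h3
  have happ : Approximates a b p R θs ψs (fun n => empirical (fun i => X i ω) n) F₀ :=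
    ⟨(eventually_ne_atTop 0).mono fun n hn => isProbabilityMeasure_empirical _ hn, h1, h2, h3⟩
  refine ⟨happ.tendsto_L hab hp hR hmax hl, happ.eventually_exists_isArgmax hab hp hR,
    fun θhat ψhat hhat => ?_⟩
  obtain ⟨hθ, hconv⟩ := happ.tendsto_isArgmax hab hp hR hmax huniq hl hhat
  have hmem : ∀ᶠ n in atTop, ψhat n ∈ SC₀ := hhat.mono fun n hn => hn.1
  have hlC : ((l - 1 : ℝ) : EReal) < L F₀ := by
    rw [hl, EReal.coe_lt_coe_iff]
    linarith
  have hψA := (henv F₀ θs ψs hsp.left hsp.right hsp.moment hψ (hψL ▸ hlC.le)).2.2.1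
  have hA' : ∀ᶠ n in atTop, ∀ x, ψhat n x ≤ ((A - α * |x| : ℝ) : EReal) := by
    filter_upwards [happ.prob, h1, hhat, happ.eventually_le_L hmax hlC] with n k1 k2 k3 k4
    obtain ⟨k5, k6⟩ := isArgmax_iff.1 k3
    exact (henv _ _ _ k2.left k2.right k2.moment k5 (k6 ▸ k4.le)).2.2.1
  refine ⟨hθ, hconv.tendsto, hconv.limsup_le,
    fun x hx => hconv.tendsto_expOf_of_continuousAt hψ hx, fun α₁ hα₁ => ⟨?_, fun hcont => ?_⟩⟩
  · exact tendsto_lintegral_weighted hα₁ hψ hmem hconv hψA hA'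
  · exact tendsto_iSup_weighted hα₁ hψ hmem hconv hψA hA' hcont
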